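/- **Problems.** An elastic-degenerate (ED) string is a sequence $\tilde T=\tilde T[1]\cdots\tilde T[n]$ of finite non-empty sets of strings; $n$ is its length and its size $N$ is the total length of all strings in all the sets. A string $P$ matches an ED string $\tilde X$ if either $|\tilde X|=1$ and $P$ is a substring of some string in $\tilde X[1]$, or $|\tilde X|>1$ and $P=P_1\cdots P_{|\tilde X|}$ where $P_1$ is a non-empty suffix of some string in $\tilde X[1]$, $P_{|\tilde X|}$ is a non-empty prefix of some string in $\tilde X[|\tilde X|]$, and $P_i\in\tilde X[i]$ for $1<i<|\tilde X|$. Elastic-degenerate string matching (EDSM): given a non-empty pattern $P$ of length $m$ and an ED string $\tilde T$ of length $n$ and size $N\ge m$, decide for every position $j\in\{1,\dots,n\}$ whether $P$ matches $\tilde T[i]\cdots\tilde T[j]$ for some $i\le j$. Triangle detection (TD): given Boolean matrices $A,B,C$ of order $\mathcal N\times\mathcal N$, $\mathcal N\ge1$, decide whether there are $i,j,k$ with $A[i,j]=B[j,k]=C[k,i]=1$. **Algorithms.** Algorithms are programs of a word RAM with words of $w$ bits, which have to be correct and meet their time bound whenever $w\ge\kappa\log_2(\text{input size})$, for some constant $\kappa$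 of the algorithm (the input size accounts also for the largest letter). Inputs are groups of strings of numbers with random access to every letter. Since "combinatorial" has no formal definition, the result is stated relative to an arbitrary set $\mathcal S$ of programs that are granted to be combinatorial: the *combinatorial* algorithms are those in $\mathcal S$ and, recursively, those which transform their input by a word RAM program computing a *local* map (the lengths of all strings of the result depend only on the lengths of the strings of the argument and, for given lengths, each letter of the result is determined by a single letter of the argument), run a combinatorial algorithm on the result, and output the disjunction of its output bits. The time of the transformation counts. **Theorem.** For every $\mathcal S$ and every $\varepsilon>0$: if EDSM can be solved in $\mathcal O(n\,m^{1.5-\varepsilon}+N)$ time by a combinatorial algorithm, then there is a truly subcubic combinatorial algorithm for TD, i.e. one that solves TD in $\mathcal O(\mathcal N^{3-\delta})$ time for some $\delta>0$. -/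

import Mathlib

namespace EDSM

/-! ### Word RAM programs

The memory of the machine consists of banks, each an array of words addressed by words. A program
mentions finitely many banks. Words are natural numbers below `2 ^ w`, where `w` is the word size;
every elementary operation costs one step. -/

/-- Binary operations on words. -/
inductive Op where
  | add | sub | mul | div | mod | and | or | xor | shl | shr | lt | eq

/-- The value of an operation at word size `w` (arithmetic is modulo `2 ^ w`). -/
def Op.eval (w : ℕ) : Op → ℕ → ℕ → ℕ
  | .add, a, b => (a + b) % 2 ^ w
  | .sub, a, b => (a + (2 ^ w - b)) % 2 ^ w
  | .mul, a, b => (a * b) % 2 ^ w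
  | .div, a, b => (a / b) % 2 ^ w
  | .mod, a, b => (a % b) % 2 ^ w
  | .and, a, b => (a &&& b) % 2 ^ w
  | .or, a, b => (a ||| b) % 2 ^ w
  | .xor, a, b => (a ^^^ b) % 2 ^ w
  | .shl, a, b => (a <<< b) % 2 ^ w
  | .shr, a, b => (a >>> b) % 2 ^ w
  | .lt, a, b => (if a < b then 1 else 0) % 2 ^ w
  | .eq, a, b => (if a = b then 1 else 0) % 2 ^ w

/-- A memory: `σ b a` is the word at address `a` of bank `b`. -/
abbrev Mem := ℕ → ℕ → ℕ

/-- Expressions: constants, reading a cell of a bank, binary operations. -/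
inductive Expr where
  | const (c : ℕ)
  | load (b : ℕ) (addr : Expr)
  | bin (o : Op) (e₁ e₂ : Expr)

/-- The value of an expression. -/
def Expr.eval (w : ℕ) (σ : Mem) : Expr → ℕ
  | .const c => c % 2 ^ w
  | .load b e => σ b (e.eval w σ)
  | .bin o e₁ e₂ => o.eval w (e₁.eval w σ) (e₂.eval w σ)

/-- The number of steps that evaluating an expression takes. -/
def Expr.cost : Expr → ℕ
  | .const _ => 1
  | .load _ e => e.cost + 1
  | .bin _ e₁ e₂ => e₁.cost + e₂.cost + 1

/-- Programs; tests succeed on nonzero words. -/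
inductive Prog where
  | skip
  | store (b : ℕ) (addr val : Expr)
  | seq (p q : Prog)
  | ite (c : Expr) (p q : Prog)
  | while (c : Expr) (p : Prog)

/-- `Exec w p σ σ' t`: at word size `w`, the program `p` started in the memory `σ` halts
after exactly `t` steps in the memory `σ'`. -/
inductive Exec (w : ℕ) : Prog → Mem → Mem → ℕ → Prop
  | skip (σ : Mem) : Exec w .skip σ σ 1
  | store (σ : Mem) (b : ℕ) (e₁ e₂ : Expr) :
      Exec w (.store b e₁ e₂) σ
        (Function.update σ b (Function.update (σ b) (e₁.eval w σ) (e₂.eval w σ)))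
        (e₁.cost + e₂.cost + 1)
  | seq {p q : Prog} {σ σ₁ σ₂ : Mem} {t₁ t₂ : ℕ} :
      Exec w p σ σ₁ t₁ → Exec w q σ₁ σ₂ t₂ → Exec w (.seq p q) σ σ₂ (t₁ + t₂)
  | iteTrue {c : Expr} {p q : Prog} {σ σ' : Mem} {t : ℕ} :
      c.eval w σ ≠ 0 → Exec w p σ σ' t → Exec w (.ite c p q) σ σ' (c.cost + 1 + t)
  | iteFalse {c : Expr} {p q : Prog} {σ σ' : Mem} {t : ℕ} :
      c.eval w σ = 0 → Exec w q σ σ' t → Exec w (.ite c p q) σ σ' (c.cost + 1 + t)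
  | whileTrue {c : Expr} {p : Prog} {σ σ₁ σ₂ : Mem} {t₁ t₂ : ℕ} :
      c.eval w σ ≠ 0 → Exec w p σ σ₁ t₁ → Exec w (.while c p) σ₁ σ₂ t₂ →
      Exec w (.while c p) σ σ₂ (c.cost + 1 + t₁ + t₂)
  | whileFalse {c : Expr} {p : Prog} {σ : Mem} :
      c.eval w σ = 0 → Exec w (.while c p) σ σ (c.cost + 1)

/-! ### Input and output -/

/-- Inputs of all problems: a list of groups, each an array of strings of numbers. -/
abbrev Data := List (List (List ℕ))

/-- All letters of an input, in order. -/
def letters (x : Data) : List ℕ := x.flatten.flatten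

/-- The shape of an input: the lengths of the strings of each group. -/
def shape (x : Data) : List (List ℕ) := x.map fun g => g.map List.length

/-- The initial memory on input `x`. Bank 0 holds the letters; bank 1 the position of the first
letter of each string; bank 2 the number of the first string of each group (both with a final
entry for the end); bank 3 the numbers of groups, strings and letters. Everything else is 0. -/
def enc (x : Data) : Mem := fun b a =>
  match b with
  | 0 => (letters x).getD a 0
  | 1 => if a ≤ x.flatten.length then (x.flatten.take a).flatten.length else 0
  | 2 => if a ≤ x.length then (x.take a).flatten.length else 0
  | 3 => [x.length, x.flatten.length, (letters x).length].getD a 0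
  | _ => 0

/-- The size of an input: it bounds the number of groups, strings and letters and the letters. -/
def dataSize (x : Data) : ℕ :=
  x.length + x.flatten.length + (letters x).length + (letters x).foldr max 0 + 2

/-- Words have at least `κ * log₂ (size of the input)` bits. -/
def Fits (κ w : ℕ) (x : Data) : Prop := dataSize x ^ κ ≤ 2 ^ w

/-- The output is a bit vector of length `n` whose `j`-th bit (from `j = 0` on) says whether `p j`
holds: bank 4 holds its length, followed by its bits (nonzero for true). -/
def Outputs (σ : Mem) (n : ℕ) (p : ℕ → Prop) : Prop :=
  σ 4 0 = n ∧ ∀ j < n, (σ 4 (j + 1) ≠ 0 ↔ p j)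

/-! ### Elastic-degenerate string matching -/

/-- The pattern `P` matches the ED string `X` (a list of sets of strings, given as arrays). -/
def Matches {α : Type*} (P : List α) (X : List (List (List α))) : Prop :=
  (∃ S, X = [S] ∧ ∃ u ∈ S, P <:+: u) ∨
  ∃ S Y S', X = S :: (Y ++ [S']) ∧ ∃ p qs p', P = p ++ qs.flatten ++ p' ∧ p ≠ [] ∧ p' ≠ [] ∧
    (∃ u ∈ S, p <:+ u) ∧ List.Forall₂ (fun q R => q ∈ R) qs Y ∧ (∃ u ∈ S', p' <+: u)

/-- An occurrence of `P` ends at the `j`-th segment of `T` (segments are counted from 0). -/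
def OccEndsAt {α : Type*} (P : List α) (T : List (List (List α))) (j : ℕ) : Prop :=
  j < T.length ∧ ∃ i ≤ j, Matches P ((T.take (j + 1)).drop i)

/-- The size of an ED string: the total length of all strings in it. -/
def textSize {α : Type*} (T : List (List (List α))) : ℕ := T.flatten.flatten.length

/-- Instances of EDSM: a nonempty pattern, and a text whose segments are finite nonempty sets
(listed without repetition), of size at least the length of the pattern. -/
def IsInstance {α : Type*} (P : List α) (T : List (List (List α))) : Prop :=
  P ≠ [] ∧ (∀ S ∈ T, S ≠ [] ∧ S.Nodup) ∧ P.length ≤ textSize T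

/-- `M` solves EDSM in time `O(τ m n N)`, where `m` is the length of the pattern and `n` and `N`
are the length and the size of the text. -/
def SolvesEDSM (M : Prog) (τ : ℕ → ℕ → ℕ → ℝ) : Prop :=
  ∃ (K : ℝ) (κ : ℕ), ∀ (P : List ℕ) (T : Data), IsInstance P T →
    ∀ w, Fits κ w ([P] :: T) → ∃ σ t, Exec w M (enc ([P] :: T)) σ t ∧
      Outputs σ T.length (OccEndsAt P T) ∧ (t : ℝ) ≤ K * τ P.length T.length (textSize T)

/-! ### Triangle detection -/

/-- The rows of a Boolean matrix. -/
def rows {n : ℕ} (A : Matrix (Fin n) (Fin n) Bool) : List (List ℕ) :=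
  List.ofFn fun i => List.ofFn fun j => (A i j).toNat

/-- `M` solves triangle detection on `n × n` matrices, `n ≥ 1`, in time `O(τ n)`. -/
def SolvesTD (M : Prog) (τ : ℕ → ℝ) : Prop :=
  ∃ (K : ℝ) (κ : ℕ), ∀ (n : ℕ) (A B C : Matrix (Fin n) (Fin n) Bool), 1 ≤ n →
    ∀ w, Fits κ w [rows A, rows B, rows C] →
      ∃ σ t, Exec w M (enc [rows A, rows B, rows C]) σ t ∧
        Outputs σ 1 (fun _ => ∃ i j k, A i j = true ∧ B j k = true ∧ C k i = true) ∧
        (t : ℝ) ≤ K * τ n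

/-- `M` is a truly subcubic algorithm for triangle detection. -/
def IsTrulySubcubicTD (M : Prog) : Prop :=
  ∃ δ : ℝ, 0 < δ ∧ SolvesTD M fun n => (n : ℝ) ^ (3 - δ)

/-! ### Combinatorial algorithms

Which algorithms are combinatorial is a matter of convention: any set `𝒮` of programs may be taken
as the stock of combinatorial ones. What is derived from them may only be preprocessed by maps each
of whose output letters is determined by a single input letter (so the preprocessing cannot add,
multiply or otherwise combine matrix entries), and postprocessed by taking a disjunction. -/

/-- A map of inputs is local if the shape of the result depends only on the shape of the argument
and, for each shape, every letter of the result depends on a single letter of the argument. -/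
def IsLocal (f : Data → Data) : Prop :=
  (∀ x y, shape x = shape y → shape (f x) = shape (f y)) ∧
  ∀ (s : List (List ℕ)) (q : ℕ), ∃ p, ∀ x y, shape x = s → shape y = s →
    (letters x).getD p 0 = (letters y).getD p 0 →
    (letters (f x)).getD q 0 = (letters (f y)).getD q 0

/-- `R` turns every input `x` into the input `f x` for a program that lives in the banks from `k`
on, if the word size is large enough. -/
def Transforms (R : Prog) (k : ℕ) (f : Data → Data) : Prop :=
  ∃ κ : ℕ, ∀ x w, Fits κ w x →
    ∃ σ t, Exec w R (enc x) σ t ∧ ∀ b a, σ (k + b) a = enc (f x) b a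

/-- Renaming bank `b` to `k + b` in an expression. -/
def Expr.shift (k : ℕ) : Expr → Expr
  | .const c => .const c
  | .load b e => .load (k + b) (e.shift k)
  | .bin o e₁ e₂ => .bin o (e₁.shift k) (e₂.shift k)

/-- Renaming bank `b` to `k + b` in a program. -/
def Prog.shift (k : ℕ) : Prog → Prog
  | .skip => .skip
  | .store b e₁ e₂ => .store (k + b) (e₁.shift k) (e₂.shift k)
  | .seq p q => .seq (p.shift k) (q.shift k)
  | .ite c p q => .ite (c.shift k) (p.shift k) (q.shift k)
  | .while c p => .while (c.shift k) (p.shift k)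

/-- Outputs the single bit that is the disjunction of the bit vector which the program that lives
in the banks from `k` on has put out (in bank `k + 4`, with its length in cell 0). -/
def disjunction (k : ℕ) : Prog :=
  let len := Expr.load (k + 4) (.const 0)
  .seq (.store 4 (.const 0) (.const 1)) <|
  .seq (.store 4 (.const 1) (.const 0)) <|
  .while len <|
    .seq (.ite (.load (k + 4) len) (.store 4 (.const 1) (.const 1)) .skip)
      (.store (k + 4) (.const 0) (.bin .sub len (.const 1)))

/-- Run `R`, then `M` in the banks from `k` on, then take the disjunction of the output of `M`. -/
def reduceTo (k : ℕ) (R M : Prog) : Prog := .seq R (.seq (M.shift k) (disjunction k))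

/-- The combinatorial algorithms relative to the stock `𝒮`: those in `𝒮`, and those that run a
combinatorial algorithm on a locally transformed input and output the disjunction of its output
bits. -/
inductive Combinatorial (𝒮 : Set Prog) : Prog → Prop
  | base {M : Prog} : M ∈ 𝒮 → Combinatorial 𝒮 M
  | reduce {R M : Prog} {k : ℕ} {f : Data → Data} : 5 ≤ k → IsLocal f → Transforms R k f →
      Combinatorial 𝒮 M → Combinatorial 𝒮 (reduceTo k R M)

end EDSM

/-!
Let `r` be the `q`-th root of `n`, rounded up, and pad the matrices with zeros to order `r ^ q`. The
columns fall into `r` blocks of `b = r ^ (q - 1)` columns. The pattern has one piece for each choice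
of a row `i` and of the blocks of `j` and `k`: three separators that name these choices, with `b`
zeros in between. A single segment has strings for all entries `i`, `j` of the first matrix, and
likewise for the other two; such strings join to form a piece only if the zeros after `j` and before
`j`, and those after `k` and before `k`, add up to `b`, that is, if the three entries form a
triangle. Since a segment cannot guess an arbitrary part of the pattern to be skipped before and
after the piece, these parts are expanded in base `r`, with `r` segments for each digit.

So the text has length `O(r)`, the pattern has length `m = O(r ^ (2 * q + 1))`, and the size of the
text is `O(r ^ (3 * q - 1)) = O(n ^ (3 - 1 / q))`. If `2 / q ≤ ε`, then the term
`r * m ^ (3 / 2 - ε)` is of this order as well. Each letter depends on at most one entry of the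
matrices.

The instance has to be written by a word RAM program in time linear in its size. It is therefore
described in a small language of bounded loops which is compiled once and for all to programs, and
for which locality and the running time can be read off from the description.
-/

namespace EDSM

/-! ### Memory and counters -/

/-- The memory after writing `v` to cell `a` of bank `b`. -/
def Mem.write (σ : Mem) (b a v : ℕ) : Mem :=
  Function.update σ b (Function.update (σ b) a v)

theorem Mem.write_apply (σ : Mem) (b a v b' a' : ℕ) :
    σ.write b a v b' a' = if b' = b ∧ a' = a then v else σ b' a' := by
  by_cases hb : b' = b
  · subst hb
    simp [Mem.write, Function.update_apply]
  · simp [Mem.write, hb]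

@[simp]
theorem Mem.write_self (σ : Mem) (b a v : ℕ) : σ.write b a v b a = v := by
  simp [Mem.write_apply]

theorem Mem.write_of_bank_ne {σ : Mem} {b a v b' a' : ℕ} (h : b' ≠ b) :
    σ.write b a v b' a' = σ b' a' := by
  simp [Mem.write_apply, h]

theorem Mem.write_of_cell_ne {σ : Mem} {b a v b' a' : ℕ} (h : a' ≠ a) :
    σ.write b a v b' a' = σ b' a' := by
  simp [Mem.write_apply, h]

theorem Exec.write {w : ℕ} (σ : Mem) (b : ℕ) (e₁ e₂ : Expr) :
    Exec w (.store b e₁ e₂) σ (σ.write b (e₁.eval w σ) (e₂.eval w σ))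
      (e₁.cost + e₂.cost + 1) :=
  .store σ b e₁ e₂

/-- The expression that reads the cell of bank `b` with the fixed address `c`. -/
def cell (b c : ℕ) : Expr := .load b (.const c)

/-- The program that adds one to the cell of bank `b` with the fixed address `c`. -/
def increment (b c : ℕ) : Prog := .store b (.const c) (.bin .add (cell b c) (.const 1))

theorem eval_cell {w b c : ℕ} {σ : Mem} (hc : c < 2 ^ w) : (cell b c).eval w σ = σ b c := by
  simp only [cell, Expr.eval, Nat.mod_eq_of_lt hc]

theorem exec_increment {w b c : ℕ} {σ : Mem} (hc : c < 2 ^ w) (h : σ b c + 1 < 2 ^ w) :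
    Exec w (increment b c) σ (σ.write b c (σ b c + 1)) 6 := by
  have hval : (Expr.bin .add (cell b c) (.const 1)).eval w σ = σ b c + 1 := by
    simp only [Expr.eval, eval_cell hc, Op.eval, Nat.mod_eq_of_lt (show 1 < 2 ^ w by omega),
      Nat.mod_eq_of_lt h]
  have haddr : (Expr.const c).eval w σ = c := Nat.mod_eq_of_lt hc
  have hstore := Exec.write (w := w) σ b (.const c) (.bin .add (cell b c) (.const 1))
  rwa [hval, haddr] at hstore

theorem exec_store_const {w b c : ℕ} {σ : Mem} (hc : c < 2 ^ w) (e : Expr) :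
    Exec w (.store b (.const c) e) σ (σ.write b c (e.eval w σ)) (e.cost + 2) := by
  have haddr : (Expr.const c).eval w σ = c := Nat.mod_eq_of_lt hc
  have hcost : (Expr.const c).cost + e.cost + 1 = e.cost + 2 := by
    simp only [Expr.cost]
    omega
  simpa only [haddr, hcost] using Exec.write (w := w) σ b (.const c) e

/-! ### Arithmetic expressions -/

/-- Operations on natural numbers; subtraction is truncated, and comparison yields 0 or 1. -/
inductive ArithOp where
  | add | sub | mul | div | mod | lt

/-- The value of an operation on natural numbers. -/
def ArithOp.eval : ArithOp → ℕ → ℕ → ℕ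
  | .add, a, b => a + b
  | .sub, a, b => a - b
  | .mul, a, b => a * b
  | .div, a, b => a / b
  | .mod, a, b => a % b
  | .lt, a, b => if a < b then 1 else 0

/-- Arithmetic expressions over natural numbers. Variables are de Bruijn levels: variable `v` was
bound inside the scope of exactly `v` others. -/
inductive Arith where
  | var (v : ℕ)
  | const (c : ℕ)
  | bin (o : ArithOp) (e₁ e₂ : Arith)

/-- The value of an expression; variables beyond the environment are zero. -/
def Arith.eval (env : List ℕ) : Arith → ℕ
  | .var v => env.getD v 0
  | .const c => c
  | .bin o e₁ e₂ => o.eval (e₁.eval env) (e₂.eval env)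

/-- All numbers that occur in the evaluation of an expression are below `M`, so that words with
values below `M` do not overflow. -/
def Arith.Safe (M : ℕ) (env : List ℕ) : Arith → Prop
  | .var v => v < M ∧ env.getD v 0 < M
  | .const c => c < M
  | .bin o e₁ e₂ => e₁.Safe M env ∧ e₂.Safe M env ∧ o.eval (e₁.eval env) (e₂.eval env) < M

/-- The operation as an expression of the machine. The difference of words wraps around when it is
negative, hence the factor that makes it zero in this case. -/
def ArithOp.compile : ArithOp → Expr → Expr → Expr
  | .add, a, b => .bin .add a b
  | .sub, a, b => .bin .mul (.bin .sub a b) (.bin .lt b a)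
  | .mul, a, b => .bin .mul a b
  | .div, a, b => .bin .div a b
  | .mod, a, b => .bin .mod a b
  | .lt, a, b => .bin .lt a b

/-- An arithmetic expression as an expression of the machine, where the values of the first `d`
variables are stored in bank 5. -/
def Arith.compile (d : ℕ) : Arith → Expr
  | .var v => if v < d then cell 5 v else .const 0
  | .const c => .const c
  | .bin o e₁ e₂ => o.compile (e₁.compile d) (e₂.compile d)

theorem Arith.Safe.lt {M : ℕ} {env : List ℕ} {e : Arith} (h : e.Safe M env) : e.eval env < M := by
  cases e with
  | var v => exact h.2
  | const c => exact h
  | bin o a b => exact h.2.2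

theorem Arith.Safe.mono {M M' : ℕ} (hM : M ≤ M') {env : List ℕ} {e : Arith} (h : e.Safe M env) :
    e.Safe M' env := by
  induction e with
  | var v => exact ⟨h.1.trans_le hM, h.2.trans_le hM⟩
  | const c => exact Nat.lt_of_lt_of_le h hM
  | bin o a b iha ihb => exact ⟨iha h.1, ihb h.2.1, h.2.2.trans_le hM⟩

theorem ArithOp.eval_compile {w : ℕ} {σ : Mem} {a b : Expr} (o : ArithOp)
    (ha : a.eval w σ < 2 ^ w) (hb : b.eval w σ < 2 ^ w)
    (h : o.eval (a.eval w σ) (b.eval w σ) < 2 ^ w) :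
    (o.compile a b).eval w σ = o.eval (a.eval w σ) (b.eval w σ) := by
  cases o <;> simp only [ArithOp.compile, Expr.eval, Op.eval, ArithOp.eval] at h ⊢
  case sub =>
    rcases Nat.lt_or_ge (b.eval w σ) (a.eval w σ) with hlt | hge
    · have hwrap : a.eval w σ + (2 ^ w - b.eval w σ) = (a.eval w σ - b.eval w σ) + 2 ^ w := by
        omega
      have hone : 1 % 2 ^ w = 1 := Nat.mod_eq_of_lt (by omega)
      rw [if_pos hlt, hwrap, hone, Nat.add_mod_right, mul_one, Nat.mod_mod, Nat.mod_eq_of_lt h]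
    · rw [if_neg hge.not_gt, Nat.zero_mod, mul_zero, Nat.zero_mod, Nat.sub_eq_zero_of_le hge]
  all_goals exact Nat.mod_eq_of_lt h

theorem Arith.eval_compile {w : ℕ} {σ : Mem} {env : List ℕ} (e : Arith)
    (hσ : ∀ v < env.length, σ 5 v = env.getD v 0) (h : e.Safe (2 ^ w) env) :
    (e.compile env.length).eval w σ = e.eval env := by
  induction e with
  | var v =>
    simp only [Arith.compile, Arith.eval]
    split
    · next hv => rw [eval_cell h.1, hσ v hv]
    · next hv => rw [List.getD_eq_default _ _ (not_lt.1 hv), Expr.eval, Nat.zero_mod]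
  | const c => exact Nat.mod_eq_of_lt h
  | bin o a b iha ihb =>
    have ha := iha h.1
    have hb := ihb h.2.1
    simp only [Arith.compile, Arith.eval]
    rw [ArithOp.eval_compile o (ha ▸ h.1.lt) (hb ▸ h.2.1.lt) (by rw [ha, hb]; exact h.2.2), ha, hb]

/-! ### Generators -/

/-- A letter that is still to be determined: it will be `yes` if the letter of the input at
position `pos` is nonzero, and `no` otherwise. -/
structure Slot where
  pos : ℕ
  yes : ℕ
  no : ℕ

/-- The letter that a slot stands for on the input with letters `L`. -/
def Slot.inst (L : ℕ → ℕ) (s : Slot) : ℕ := if L s.pos = 0 then s.no else s.yes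

/-- The items of the description of an input: a letter, the end of a string, the end of a group. -/
inductive Token where
  | letter (s : Slot)
  | endString
  | endGroup

/-- A language of straight-line emissions and bounded loops, used to describe local maps together
with programs that compute them: its tests and loop bounds do not depend on the letters of the
input, and each emitted letter depends on at most one of them. -/
inductive Gen where
  | skip
  | emit (pos yes no : Arith)
  | endString
  | endGroup
  | seq (G H : Gen)
  | letIn (e : Arith) (G : Gen)
  | guard (e : Arith) (G : Gen)
  | loop (e : Arith) (G : Gen)

/-- The items that a generator puts out. -/
def Gen.tokens : Gen → List ℕ → List Token
  | .skip, _ => []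
  | .emit p y n, env => [.letter ⟨p.eval env, y.eval env, n.eval env⟩]
  | .endString, _ => [.endString]
  | .endGroup, _ => [.endGroup]
  | .seq G H, env => G.tokens env ++ H.tokens env
  | .letIn e G, env => G.tokens (env ++ [e.eval env])
  | .guard e G, env => if e.eval env = 0 then [] else G.tokens env
  | .loop e G, env => (List.range (e.eval env)).flatMap fun i => G.tokens (env ++ [i])

/-- The work of a generator, which measures its running time up to a constant factor. -/
def Gen.work : Gen → List ℕ → ℕ
  | .skip, _ => 1
  | .emit _ _ _, _ => 1
  | .endString, _ => 1
  | .endGroup, _ => 1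
  | .seq G H, env => G.work env + H.work env
  | .letIn e G, env => 1 + G.work (env ++ [e.eval env])
  | .guard e G, env => 1 + if e.eval env = 0 then 0 else G.work env
  | .loop e G, env => 1 + ((List.range (e.eval env)).map fun i => 1 + G.work (env ++ [i])).sum

/-- All values and addresses that occur in the run of a generator are below `M`. -/
def Gen.Safe (M : ℕ) : Gen → List ℕ → Prop
  | .skip, _ => True
  | .emit p y n, env => p.Safe M env ∧ y.Safe M env ∧ n.Safe M env
  | .endString, _ => True
  | .endGroup, _ => True
  | .seq G H, env => G.Safe M env ∧ H.Safe M env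
  | .letIn e G, env => e.Safe M env ∧ env.length < M ∧ G.Safe M (env ++ [e.eval env])
  | .guard e G, env => e.Safe M env ∧ G.Safe M env
  | .loop e G, env => e.Safe M env ∧ env.length < M ∧ ∀ i < e.eval env, G.Safe M (env ++ [i])

theorem Gen.Safe.mono {M M' : ℕ} (hM : M ≤ M') {G : Gen} {env : List ℕ} (h : G.Safe M env) :
    G.Safe M' env := by
  induction G generalizing env with
  | skip | endString | endGroup => trivial
  | emit p y n => exact ⟨h.1.mono hM, h.2.1.mono hM, h.2.2.mono hM⟩
  | seq G H ihG ihH => exact ⟨ihG h.1, ihH h.2⟩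
  | letIn e G ih => exact ⟨h.1.mono hM, h.2.1.trans_le hM, ih h.2.2⟩
  | guard e G ih => exact ⟨h.1.mono hM, ih h.2⟩
  | loop e G ih => exact ⟨h.1.mono hM, h.2.1.trans_le hM, fun i hi => ih (h.2.2 i hi)⟩

theorem Gen.length_tokens_le_work (G : Gen) (env : List ℕ) :
    (G.tokens env).length ≤ G.work env := by
  induction G generalizing env with
  | skip | emit | endString | endGroup => simp [Gen.tokens, Gen.work]
  | seq G H ihG ihH =>
    simpa only [Gen.tokens, Gen.work, List.length_append] using add_le_add (ihG env) (ihH env)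
  | letIn e G ih => exact (ih _).trans (Nat.le_add_left ..)
  | guard e G ih =>
    simp only [Gen.tokens, Gen.work]
    split
    · exact Nat.zero_le _
    · exact (ih env).trans (Nat.le_add_left ..)
  | loop e G ih =>
    simp only [Gen.tokens, Gen.work, List.length_flatMap]
    exact (List.sum_le_sum fun i _ => (ih _).trans (Nat.le_add_left ..)).trans
      (Nat.le_add_left ..)

/-- The loop that runs `p` with the values from that of variable `d` up to the one of `e`. -/
def upTo (d : ℕ) (e : Expr) (p : Prog) : Prog :=
  .while (.bin .lt (cell 5 d) e) (.seq p (increment 5 d))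

/-- The program of a generator with `d` free variables. It reads the input in bank 0, keeps the
variables in bank 5, and writes the output to the banks from 6 on, laid out as by `enc`; so the
numbers of groups, strings and letters in bank 9 serve as counters. -/
def Gen.compile : ℕ → Gen → Prog
  | _, .skip => .skip
  | d, .emit p y n =>
    .seq (.ite (.load 0 (p.compile d)) (.store 6 (cell 9 2) (y.compile d))
      (.store 6 (cell 9 2) (n.compile d))) (increment 9 2)
  | _, .endString => .seq (increment 9 1) (.store 7 (cell 9 1) (cell 9 2))
  | _, .endGroup => .seq (increment 9 0) (.store 8 (cell 9 0) (cell 9 1))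
  | d, .seq G H => .seq (G.compile d) (H.compile d)
  | d, .letIn e G => .seq (.store 5 (.const d) (e.compile d)) (G.compile (d + 1))
  | d, .guard e G => .ite (e.compile d) (G.compile d) .skip
  | d, .loop e G =>
    .seq (.store 5 (.const d) (.const 0)) (upTo d (e.compile d) (G.compile (d + 1)))

/-! ### Partial outputs -/

/-- The part of an output that has been produced so far, in the layout of `enc`: the letters, the
positions at which the strings end, and the numbers of the strings at which the groups end. -/
structure Acc where
  ltr : List ℕ
  str : List ℕ
  grp : List ℕ

/-- Adding an item to a partial output, where `L` is the bank that the letters are read from. -/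
def Acc.push (L : ℕ → ℕ) (A : Acc) : Token → Acc
  | .letter s => { A with ltr := A.ltr ++ [s.inst L] }
  | .endString => { A with str := A.str ++ [A.ltr.length] }
  | .endGroup => { A with grp := A.grp ++ [A.str.length] }

/-- Adding a list of items to a partial output. -/
def Acc.run (L : ℕ → ℕ) (A : Acc) (l : List Token) : Acc := l.foldl (Acc.push L) A

/-- The number of items of a partial output. -/
def Acc.size (A : Acc) : ℕ := A.ltr.length + A.str.length + A.grp.length

/-- The banks that hold a partial output. -/
def Acc.mem (A : Acc) : Mem := fun b a =>
  match b with
  | 0 => A.ltr.getD a 0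
  | 1 => (0 :: A.str).getD a 0
  | 2 => (0 :: A.grp).getD a 0
  | 3 => [A.grp.length, A.str.length, A.ltr.length].getD a 0
  | _ => 0

theorem Acc.size_push (L : ℕ → ℕ) (A : Acc) (t : Token) : (A.push L t).size = A.size + 1 := by
  cases t <;> simp only [Acc.push, Acc.size, List.length_append, List.length_singleton] <;> omega

theorem Acc.run_append (L : ℕ → ℕ) (A : Acc) (l l' : List Token) :
    A.run L (l ++ l') = (A.run L l).run L l' := List.foldl_append ..

theorem Acc.size_run (L : ℕ → ℕ) (A : Acc) (l : List Token) :
    (A.run L l).size = A.size + l.length := by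
  induction l generalizing A with
  | nil => rfl
  | cons t l ih =>
    rw [List.length_cons, add_comm l.length, ← add_assoc, ← Acc.size_push L A t]
    exact ih (A.push L t)

theorem getD_append_singleton {α : Type*} (l : List α) (x d : α) (a : ℕ) :
    (l ++ [x]).getD a d = if a = l.length then x else l.getD a d := by
  rcases lt_trichotomy a l.length with h | rfl | h
  · rw [List.getD_append _ _ _ _ h, if_neg h.ne]
  · simp
  · rw [if_neg h.ne', List.getD_eq_default _ _ h.le, List.getD_eq_default _ _ (by simpa using h)]

theorem getD_cons_append_singleton {α : Type*} (y : α) (l : List α) (x d : α) (a : ℕ) :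
    (y :: (l ++ [x])).getD a d = if a = l.length + 1 then x else (y :: l).getD a d := by
  rw [← List.cons_append, getD_append_singleton, List.length_cons]

/-! ### Correctness of the compiled programs -/

/-- The memory during the run of a generator: the input is `L`, the values of the variables are
`env`, and the output so far is `A`. -/
structure Gen.Invariant (L : ℕ → ℕ) (env : List ℕ) (A : Acc) (σ : Mem) : Prop where
  input : ∀ a, σ 0 a = L a
  vars : ∀ v < env.length, σ 5 v = env.getD v 0
  out : ∀ b a, σ (6 + b) a = A.mem b a

section

variable {w : ℕ} {L : ℕ → ℕ} {env : List ℕ} {A : Acc} {σ : Mem}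

namespace Gen.Invariant

theorem pop {i : ℕ} (h : Invariant L (env ++ [i]) A σ) : Invariant L env A σ where
  input := h.input
  vars v hv := by rw [h.vars v (by rw [List.length_append]; omega), List.getD_append _ _ _ _ hv]
  out := h.out

theorem last {i : ℕ} (h : Invariant L (env ++ [i]) A σ) : σ 5 env.length = i := by
  simp [h.vars env.length (by simp)]

theorem assign (h : Invariant L env A σ) (i : ℕ) :
    Invariant L (env ++ [i]) A (σ.write 5 env.length i) where
  input a := by rw [Mem.write_of_bank_ne (by decide), h.input]
  vars v hv := by
    rw [Mem.write_apply, getD_append_singleton]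
    simp only [true_and]
    split_ifs with hlast
    · rfl
    · exact h.vars v (by rw [List.length_append, List.length_singleton] at hv; omega)
  out b a := by rw [Mem.write_of_bank_ne (by omega), h.out]

theorem pushLetter (h : Invariant L env A σ) (v : ℕ) :
    Invariant L env { A with ltr := A.ltr ++ [v] }
      ((σ.write 6 A.ltr.length v).write 9 2 (A.ltr.length + 1)) where
  input a := by simpa [Mem.write_apply] using h.input a
  vars v hv := by simpa [Mem.write_apply] using h.vars v hv
  out b a := by
    have hout := h.out b a
    rcases b with _ | _ | _ | _ | b
    · simp only [Acc.mem, getD_append_singleton] at hout ⊢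
      simp [← hout, Mem.write_apply, -List.getD_eq_getElem?_getD]
    · simp_all [Mem.write_apply, Acc.mem]
    · simp_all [Mem.write_apply, Acc.mem]
    · rcases a with _ | _ | _ | a <;> simp_all [Mem.write_apply, Acc.mem]
    · rw [Mem.write_of_bank_ne (by omega), Mem.write_of_bank_ne (by omega)]
      exact hout

theorem pushString (h : Invariant L env A σ) (v : ℕ) :
    Invariant L env { A with str := A.str ++ [v] }
      ((σ.write 9 1 (A.str.length + 1)).write 7 (A.str.length + 1) v) where
  input a := by simpa [Mem.write_apply] using h.input a
  vars v hv := by simpa [Mem.write_apply] using h.vars v hv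
  out b a := by
    have hout := h.out b a
    rcases b with _ | _ | _ | _ | b
    · simp_all [Mem.write_apply, Acc.mem]
    · simp only [Acc.mem, getD_cons_append_singleton] at hout ⊢
      simp [← hout, Mem.write_apply, -List.getD_eq_getElem?_getD]
    · simp_all [Mem.write_apply, Acc.mem]
    · rcases a with _ | _ | _ | a <;> simp_all [Mem.write_apply, Acc.mem]
    · rw [Mem.write_of_bank_ne (by omega), Mem.write_of_bank_ne (by omega)]
      exact hout

theorem pushGroup (h : Invariant L env A σ) (v : ℕ) :
    Invariant L env { A with grp := A.grp ++ [v] }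
      ((σ.write 9 0 (A.grp.length + 1)).write 8 (A.grp.length + 1) v) where
  input a := by simpa [Mem.write_apply] using h.input a
  vars v hv := by simpa [Mem.write_apply] using h.vars v hv
  out b a := by
    have hout := h.out b a
    rcases b with _ | _ | _ | _ | b
    · simp_all [Mem.write_apply, Acc.mem]
    · simp_all [Mem.write_apply, Acc.mem]
    · simp only [Acc.mem, getD_cons_append_singleton] at hout ⊢
      simp [← hout, Mem.write_apply, -List.getD_eq_getElem?_getD]
    · rcases a with _ | _ | _ | a <;> simp_all [Mem.write_apply, Acc.mem]
    · rw [Mem.write_of_bank_ne (by omega), Mem.write_of_bank_ne (by omega)]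
      exact hout

end Gen.Invariant

theorem exec_assign (h : Gen.Invariant L env A σ) (e : Expr) (hd : env.length < 2 ^ w) :
    ∃ σ', Exec w (.store 5 (.const env.length) e) σ σ' (e.cost + 2) ∧
      Gen.Invariant L (env ++ [e.eval w σ]) A σ' :=
  ⟨_, exec_store_const hd e, h.assign _⟩

theorem exec_storeLetter (h : Gen.Invariant L env A σ) (hw : 3 ≤ 2 ^ w) (hs : A.size + 1 < 2 ^ w)
    {e : Arith} (he : e.Safe (2 ^ w) env) :
    ∃ σ₁ σ₂, Exec w (.store 6 (cell 9 2) (e.compile env.length)) σ σ₁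
        ((e.compile env.length).cost + 3) ∧ Exec w (increment 9 2) σ₁ σ₂ 6 ∧
      Gen.Invariant L env { A with ltr := A.ltr ++ [e.eval env] } σ₂ := by
  have hcount : σ 9 2 = A.ltr.length := h.out 3 2
  have hcount₁ : (σ.write 6 A.ltr.length (e.eval env)) 9 2 = A.ltr.length := by
    rw [Mem.write_of_bank_ne (by decide), hcount]
  have hlt : A.ltr.length + 1 < 2 ^ w := by simp only [Acc.size] at hs; omega
  have hstore := Exec.write (w := w) σ 6 (cell 9 2) (e.compile env.length)
  rw [eval_cell (by omega), Arith.eval_compile e h.vars he, hcount,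
    show (cell 9 2).cost = 2 from rfl, show ∀ c, 2 + c + 1 = c + 3 by omega] at hstore
  have hincr := exec_increment (show 2 < 2 ^ w by omega) (hcount₁.symm ▸ hlt)
  rw [hcount₁] at hincr
  exact ⟨_, _, hstore, hincr, h.pushLetter (e.eval env)⟩

namespace Gen

/-- The compiled program of a generator at depth `d` does what the generator says, in at most `C`
steps for each unit of work. -/
def CompilesWithin (C d : ℕ) (G : Gen) : Prop :=
  ∀ ⦃w : ℕ⦄ ⦃L : ℕ → ℕ⦄ ⦃env : List ℕ⦄ ⦃A : Acc⦄ ⦃σ : Mem⦄, env.length = d → 3 ≤ 2 ^ w →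
    G.Safe (2 ^ w) env → A.size + (G.tokens env).length < 2 ^ w → Invariant L env A σ →
    ∃ σ' t, Exec w (G.compile d) σ σ' t ∧ Invariant L env (A.run L (G.tokens env)) σ' ∧
      t ≤ C * G.work env

theorem compilesWithin_emit (d : ℕ) (p y n : Arith) :
    CompilesWithin ((p.compile d).cost + (y.compile d).cost + (n.compile d).cost + 20) d
      (.emit p y n) := by
  rintro w L env A σ rfl hw ⟨hp, hy, hn⟩ hs h
  have hcell : (Expr.load 0 (p.compile env.length)).eval w σ = L (p.eval env) := by
    rw [Expr.eval, Arith.eval_compile p h.vars hp, h.input]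
  by_cases h0 : L (p.eval env) = 0
  · obtain ⟨σ₁, σ₂, e₁, e₂, hi⟩ := exec_storeLetter h hw hs hn
    refine ⟨σ₂, _, .seq (.iteFalse (hcell.trans h0) e₁) e₂, ?_, ?_⟩
    · simpa [tokens, Acc.run, Acc.push, Slot.inst, h0] using hi
    · simp only [Expr.cost, work]; omega
  · obtain ⟨σ₁, σ₂, e₁, e₂, hi⟩ := exec_storeLetter h hw hs hy
    refine ⟨σ₂, _, .seq (.iteTrue (hcell.trans_ne h0) e₁) e₂, ?_, ?_⟩
    · simpa [tokens, Acc.run, Acc.push, Slot.inst, h0] using hi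
    · simp only [Expr.cost, work]; omega

theorem compilesWithin_endString (d : ℕ) : CompilesWithin 11 d .endString := by
  intro w L env A σ _ hw _ hs h
  have hstr : σ 9 1 = A.str.length := h.out 3 1
  have hltr : σ 9 2 = A.ltr.length := h.out 3 2
  have hlt : A.str.length + 1 < 2 ^ w := by
    simp only [Acc.size, tokens, List.length_singleton] at hs; omega
  refine ⟨_, _, .seq (exec_increment (by omega) (hstr.symm ▸ hlt)) (.write _ _ _ _), ?_, le_rfl⟩
  rw [eval_cell (by omega), eval_cell (by omega), Mem.write_self, Mem.write_of_cell_ne (by decide),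
    hstr, hltr]
  exact h.pushString A.ltr.length

theorem compilesWithin_endGroup (d : ℕ) : CompilesWithin 11 d .endGroup := by
  intro w L env A σ _ hw _ hs h
  have hgrp : σ 9 0 = A.grp.length := h.out 3 0
  have hstr : σ 9 1 = A.str.length := h.out 3 1
  have hlt : A.grp.length + 1 < 2 ^ w := by
    simp only [Acc.size, tokens, List.length_singleton] at hs; omega
  refine ⟨_, _, .seq (exec_increment (by omega) (hgrp.symm ▸ hlt)) (.write _ _ _ _), ?_, le_rfl⟩
  rw [eval_cell (by omega), eval_cell (by omega), Mem.write_self, Mem.write_of_cell_ne (by decide),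
    hgrp, hstr]
  exact h.pushGroup A.str.length

theorem CompilesWithin.seq {C C' d : ℕ} {G H : Gen} (hG : G.CompilesWithin C d)
    (hH : H.CompilesWithin C' d) : CompilesWithin (C + C') d (.seq G H) := by
  intro w L env A σ hd hw hsafe hs h
  simp only [tokens, List.length_append] at hs
  obtain ⟨σ₁, t₁, e₁, i₁, b₁⟩ := hG hd hw hsafe.1 (by omega) h
  obtain ⟨σ₂, t₂, e₂, i₂, b₂⟩ := hH hd hw hsafe.2 (by rw [Acc.size_run]; omega) i₁
  refine ⟨σ₂, _, .seq e₁ e₂, ?_, ?_⟩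
  · simpa only [tokens, Acc.run_append] using i₂
  · simp only [work]; nlinarith

theorem CompilesWithin.letIn {C d : ℕ} {e : Arith} {G : Gen} (hG : G.CompilesWithin C (d + 1)) :
    CompilesWithin ((e.compile d).cost + 2 + C) d (.letIn e G) := by
  rintro w L env A σ rfl hw ⟨hsafe_e, hd, hsafe_G⟩ hs h
  obtain ⟨σ₁, e₁, i₁⟩ := exec_assign h (e.compile env.length) hd
  rw [Arith.eval_compile e h.vars hsafe_e] at i₁
  obtain ⟨σ₂, t₂, e₂, i₂, b₂⟩ := hG (by simp) hw hsafe_G hs i₁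
  exact ⟨σ₂, _, .seq e₁ e₂, i₂.pop, by simp only [work]; nlinarith⟩

theorem CompilesWithin.guard {C d : ℕ} {e : Arith} {G : Gen} (hG : G.CompilesWithin C d) :
    CompilesWithin ((e.compile d).cost + 2 + C) d (.guard e G) := by
  rintro w L env A σ rfl hw ⟨hsafe_e, hsafe_G⟩ hs h
  have he := Arith.eval_compile e h.vars hsafe_e
  by_cases h0 : e.eval env = 0
  · refine ⟨σ, _, .iteFalse (he.trans h0) (.skip σ), ?_, ?_⟩
    · rwa [tokens, if_pos h0]
    · simp only [work, if_pos h0]; omega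
  · simp only [tokens, if_neg h0] at hs
    obtain ⟨σ₂, t₂, e₂, i₂, b₂⟩ := hG rfl hw hsafe_G hs h
    refine ⟨σ₂, _, .iteTrue (he.trans_ne h0) e₂, ?_, ?_⟩
    · simpa only [tokens, if_neg h0] using i₂
    · simp only [work, if_neg h0]; nlinarith

theorem eval_loopTest {i : ℕ} {e : Arith} (h : Invariant L (env ++ [i]) A σ)
    (he : e.Safe (2 ^ w) env) (hd : env.length < 2 ^ w) (hw : 3 ≤ 2 ^ w) :
    (Expr.bin .lt (cell 5 env.length) (e.compile env.length)).eval w σ =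
      if i < e.eval env then 1 else 0 := by
  rw [Expr.eval, eval_cell hd, h.last, Arith.eval_compile e h.pop.vars he]
  exact Nat.mod_eq_of_lt (by split <;> omega)

theorem CompilesWithin.exec_upTo {C : ℕ} {e : Arith} {G : Gen}
    (hG : G.CompilesWithin C (env.length + 1)) (hw : 3 ≤ 2 ^ w) (he : e.Safe (2 ^ w) env)
    (hd : env.length < 2 ^ w) (hsafe : ∀ i < e.eval env, G.Safe (2 ^ w) (env ++ [i])) (k i : ℕ)
    (hi : i + k = e.eval env) (h : Invariant L (env ++ [i]) A σ)
    (hs : A.size + ((List.range' i k).flatMap fun j => G.tokens (env ++ [j])).length < 2 ^ w) :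
    ∃ σ' t, Exec w (upTo env.length (e.compile env.length) (G.compile (env.length + 1))) σ σ' t ∧
      Invariant L env (A.run L ((List.range' i k).flatMap fun j => G.tokens (env ++ [j]))) σ' ∧
      t ≤ ((e.compile env.length).cost + 11 + C) *
          ((List.range' i k).map fun j => 1 + G.work (env ++ [j])).sum +
        ((e.compile env.length).cost + 4) := by
  induction k generalizing i A σ with
  | zero =>
    refine ⟨σ, _, .whileFalse ?_, h.pop, ?_⟩
    · rw [eval_loopTest h he hd hw, if_neg (by omega)]
    · simp only [cell, Expr.cost]; omega
  | succ k ih =>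
    rw [List.range'_succ, List.flatMap_cons] at hs ⊢
    rw [List.length_append] at hs
    obtain ⟨σ₁, t₁, e₁, i₁, b₁⟩ := hG (by simp) hw (hsafe i (by omega)) (by omega) h
    have hincr := exec_increment hd (σ := σ₁) (b := 5) (by have := he.lt; rw [i₁.last]; omega)
    rw [i₁.last] at hincr
    obtain ⟨σ₂, t₂, e₂, i₂, b₂⟩ := ih (i + 1) (by omega) (i₁.pop.assign (i + 1))
      (by rw [Acc.size_run]; omega)
    refine ⟨σ₂, _, .whileTrue ?_ (.seq e₁ hincr) e₂, ?_, ?_⟩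
    · rw [eval_loopTest h he hd hw, if_pos (by omega)]; exact one_ne_zero
    · rwa [Acc.run_append]
    · simp only [List.map_cons, List.sum_cons, cell, Expr.cost]
      nlinarith

theorem CompilesWithin.loop {C d : ℕ} {e : Arith} {G : Gen} (hG : G.CompilesWithin C (d + 1)) :
    CompilesWithin ((e.compile d).cost + 11 + C) d (.loop e G) := by
  rintro w L env A σ rfl hw ⟨hsafe_e, hd, hsafe_G⟩ hs h
  obtain ⟨σ₁, e₁, i₁⟩ := exec_assign h (.const 0) hd
  rw [Expr.eval, Nat.zero_mod] at i₁
  simp only [tokens, work, List.range_eq_range'] at hs ⊢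
  obtain ⟨σ₂, t₂, e₂, i₂, b₂⟩ :=
    hG.exec_upTo hw hsafe_e hd hsafe_G _ 0 (Nat.zero_add _) i₁ hs
  refine ⟨σ₂, _, .seq e₁ e₂, i₂, ?_⟩
  simp only [Expr.cost]
  nlinarith

theorem exists_compilesWithin (G : Gen) (d : ℕ) : ∃ C, G.CompilesWithin C d := by
  induction G generalizing d with
  | skip => exact ⟨1, fun w L env A σ _ _ _ _ h => ⟨σ, 1, .skip σ, h, le_rfl⟩⟩
  | emit p y n => exact ⟨_, compilesWithin_emit d p y n⟩
  | endString => exact ⟨_, compilesWithin_endString d⟩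
  | endGroup => exact ⟨_, compilesWithin_endGroup d⟩
  | seq G H ihG ihH =>
    obtain ⟨C, hG⟩ := ihG d
    obtain ⟨C', hH⟩ := ihH d
    exact ⟨_, hG.seq hH⟩
  | letIn e G ih => exact (ih (d + 1)).imp' _ fun _ hG => hG.letIn
  | guard e G ih => exact (ih d).imp' _ fun _ hG => hG.guard
  | loop e G ih => exact (ih (d + 1)).imp' _ fun _ hG => hG.loop

end Gen

end

/-! ### Polynomial bounds -/

section

open Filter

theorem ArithOp.eval_le (o : ArithOp) (a b : ℕ) : o.eval a b ≤ (a + 1) * (b + 1) := by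
  cases o <;> simp only [ArithOp.eval]
  case add | mul => nlinarith
  case sub => nlinarith [Nat.sub_le a b]
  case div => nlinarith [Nat.div_le_self a b]
  case mod => nlinarith [Nat.mod_le a b]
  case lt => split <;> nlinarith

theorem lt_pow_of_le {B v κ : ℕ} (hB : 2 ≤ B) (hv : v ≤ κ) : v < B ^ κ :=
  (Nat.lt_pow_self hB).trans_le (Nat.pow_le_pow_right (by omega) hv)

theorem Arith.eventually_safe (e : Arith) (D : ℕ) : ∀ᶠ κ in atTop, ∀ B env, 2 ≤ B →
    (∀ v, env.getD v 0 ≤ B ^ D) → e.Safe (B ^ κ) env := by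
  induction e with
  | var v =>
    filter_upwards [eventually_ge_atTop v, eventually_gt_atTop D] with κ hv hD B env hB h
    exact ⟨lt_pow_of_le hB hv, (h v).trans_lt (Nat.pow_lt_pow_right hB hD)⟩
  | const c =>
    filter_upwards [eventually_ge_atTop c] with κ hc B env hB _
    exact lt_pow_of_le hB hc
  | bin o a b iha ihb =>
    obtain ⟨κ, ha, hb⟩ := (iha.and ihb).exists
    filter_upwards [iha, ihb, eventually_gt_atTop (κ + κ)] with μ ha' hb' hμ B env hB h
    refine ⟨ha' B env hB h, hb' B env hB h, ?_⟩
    calc o.eval (a.eval env) (b.eval env)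
        ≤ (a.eval env + 1) * (b.eval env + 1) := o.eval_le _ _
      _ ≤ B ^ κ * B ^ κ := Nat.mul_le_mul (ha B env hB h).lt (hb B env hB h).lt
      _ = B ^ (κ + κ) := (pow_add ..).symm
      _ < B ^ μ := Nat.pow_lt_pow_right hB hμ

theorem Arith.exists_eval_lt (e : Arith) (D : ℕ) : ∃ κ, ∀ B env, 2 ≤ B →
    (∀ v, env.getD v 0 ≤ B ^ D) → e.eval env < B ^ κ :=
  (e.eventually_safe D).exists.imp fun _ he B env hB h => (he B env hB h).lt

theorem getD_append_singleton_le {env : List ℕ} {B D κ i : ℕ} (hB : 2 ≤ B)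
    (h : ∀ v, env.getD v 0 ≤ B ^ D) (hi : i < B ^ κ) (v : ℕ) :
    (env ++ [i]).getD v 0 ≤ B ^ (D + κ) := by
  rw [getD_append_singleton]
  split
  · exact hi.le.trans (Nat.pow_le_pow_right (by omega) (by omega))
  · exact (h v).trans (Nat.pow_le_pow_right (by omega) (by omega))

theorem Gen.eventually_safe (G : Gen) (D d : ℕ) : ∀ᶠ κ in atTop, ∀ B env, 2 ≤ B →
    env.length = d → (∀ v, env.getD v 0 ≤ B ^ D) → G.Safe (B ^ κ) env := by
  induction G generalizing D d with
  | skip | endString | endGroup => exact .of_forall fun _ _ _ _ _ _ => trivial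
  | emit p y n =>
    filter_upwards [p.eventually_safe D, y.eventually_safe D, n.eventually_safe D] with
      κ hp hy hn B env hB _ h
    exact ⟨hp B env hB h, hy B env hB h, hn B env hB h⟩
  | seq G H ihG ihH =>
    filter_upwards [ihG D d, ihH D d] with κ hG hH B env hB hd h
    exact ⟨hG B env hB hd h, hH B env hB hd h⟩
  | letIn e G ih =>
    obtain ⟨κ, he⟩ := e.exists_eval_lt D
    filter_upwards [e.eventually_safe D, eventually_ge_atTop d, ih (D + κ) (d + 1)] with
      μ he' hμ hG B env hB hd h
    exact ⟨he' B env hB h, hd ▸ lt_pow_of_le hB hμ, hG B _ hB (by simp [hd])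
      (getD_append_singleton_le hB h (he B env hB h))⟩
  | guard e G ih =>
    filter_upwards [e.eventually_safe D, ih D d] with κ he hG B env hB hd h
    exact ⟨he B env hB h, hG B env hB hd h⟩
  | loop e G ih =>
    obtain ⟨κ, he⟩ := e.exists_eval_lt D
    filter_upwards [e.eventually_safe D, eventually_ge_atTop d, ih (D + κ) (d + 1)] with
      μ he' hμ hG B env hB hd h
    exact ⟨he' B env hB h, hd ▸ lt_pow_of_le hB hμ, fun i hi => hG B _ hB (by simp [hd])
      (getD_append_singleton_le hB h (hi.trans (he B env hB h)))⟩

theorem length_flatMap_range_le {α : Type*} {f : ℕ → List α} {n c : ℕ}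
    (h : ∀ i < n, (f i).length ≤ c) : ((List.range n).flatMap f).length ≤ n * c := by
  rw [List.length_flatMap]
  simpa using List.sum_le_card_nsmul ((List.range n).map fun i => (f i).length) c (by simpa using h)

theorem Gen.eventually_length_tokens_lt (G : Gen) (D : ℕ) : ∀ᶠ κ in atTop, ∀ B env, 2 ≤ B →
    (∀ v, env.getD v 0 ≤ B ^ D) → (G.tokens env).length < B ^ κ := by
  induction G generalizing D with
  | skip | emit | endString | endGroup =>
    filter_upwards [eventually_ge_atTop 1] with κ hκ B env hB _
    exact lt_of_le_of_lt (by simp [tokens]) (lt_pow_of_le hB hκ)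
  | seq G H ihG ihH =>
    obtain ⟨κ, hG, hH⟩ := ((ihG D).and (ihH D)).exists
    filter_upwards [eventually_gt_atTop κ] with μ hμ B env hB h
    have hG' := hG B env hB h
    have hH' := hH B env hB h
    calc (G.tokens env ++ H.tokens env).length
        < 2 * B ^ κ := by rw [List.length_append]; omega
      _ ≤ B ^ (κ + 1) := by rw [pow_succ']; gcongr
      _ ≤ B ^ μ := Nat.pow_le_pow_right (by omega) hμ
  | letIn e G ih =>
    obtain ⟨κ, he⟩ := e.exists_eval_lt D
    filter_upwards [ih (D + κ)] with μ hG B env hB h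
    exact hG B _ hB (getD_append_singleton_le hB h (he B env hB h))
  | guard e G ih =>
    filter_upwards [ih D] with κ hG B env hB h
    rw [tokens]
    split
    · exact Nat.pow_pos (by omega)
    · exact hG B env hB h
  | loop e G ih =>
    obtain ⟨κ, he⟩ := e.exists_eval_lt D
    obtain ⟨μ, hG⟩ := (ih (D + κ)).exists
    filter_upwards [eventually_ge_atTop (κ + μ)] with ν hν B env hB h
    have hbody : ∀ i < e.eval env, (G.tokens (env ++ [i])).length ≤ B ^ μ := fun i hi =>
      (hG B _ hB (getD_append_singleton_le hB h (hi.trans (he B env hB h)))).le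
    calc ((Gen.loop e G).tokens env).length
        ≤ e.eval env * B ^ μ := length_flatMap_range_le hbody
      _ < B ^ κ * B ^ μ := Nat.mul_lt_mul_of_pos_right (he B env hB h) (Nat.pow_pos (by omega))
      _ = B ^ (κ + μ) := (pow_add ..).symm
      _ ≤ B ^ ν := Nat.pow_le_pow_right (by omega) hν

end

/-- The letters of an item are below `M`. -/
def Token.Below (M : ℕ) : Token → Prop
  | .letter s => s.yes < M ∧ s.no < M
  | .endString | .endGroup => True

theorem Gen.Safe.below {M : ℕ} {G : Gen} {env : List ℕ} (h : G.Safe M env) :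
    ∀ t ∈ G.tokens env, t.Below M := by
  induction G generalizing env with
  | skip => simp [Gen.tokens]
  | emit p y n => simpa [Gen.tokens] using ⟨h.2.1.lt, h.2.2.lt⟩
  | endString | endGroup => simp [Gen.tokens, Token.Below]
  | seq G H ihG ihH =>
    simp only [Gen.tokens, List.mem_append]
    rintro t (ht | ht)
    exacts [ihG h.1 t ht, ihH h.2 t ht]
  | letIn e G ih => exact ih h.2.2
  | guard e G ih =>
    simp only [Gen.tokens]
    split
    · simp
    · exact ih h.2
  | loop e G ih =>
    simp only [Gen.tokens, List.mem_flatMap, List.mem_range]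
    rintro t ⟨i, hi, ht⟩
    exact ih (h.2.2 i hi) t ht

/-! ### Templates -/

/-- Inputs of a fixed shape in which every letter depends on a single letter of another input. -/
abbrev Template := List (List (List Slot))

/-- The input that a template stands for when the other input has the letters `L`. -/
def Template.inst (L : ℕ → ℕ) (X : Template) : Data :=
  X.map fun g => g.map fun s => s.map (Slot.inst L)

/-- The items that describe the letters of a string. -/
def letterTokens (s : List Slot) : List Token := s.map .letter

/-- The items that describe a string. -/
def stringTokens (s : List Slot) : List Token := letterTokens s ++ [.endString]

/-- The items that describe a group. -/
def groupTokens (g : List (List Slot)) : List Token := g.flatMap stringTokens ++ [.endGroup]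

/-- The items that describe a template. -/
def templateTokens (X : Template) : List Token := X.flatMap groupTokens

theorem templateTokens_append (X Y : Template) :
    templateTokens (X ++ Y) = templateTokens X ++ templateTokens Y := List.flatMap_append

theorem Template.inst_append (L : ℕ → ℕ) (X Y : Template) :
    Template.inst L (X ++ Y) = Template.inst L X ++ Template.inst L Y := List.map_append

theorem shape_inst (L L' : ℕ → ℕ) (X : Template) :
    shape (X.inst L) = shape (X.inst L') := by
  simp [shape, Template.inst, Function.comp_def]

theorem letters_inst (L : ℕ → ℕ) (X : Template) :
    letters (X.inst L) = X.flatten.flatten.map (Slot.inst L) := by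
  simp [letters, Template.inst, List.map_flatten]

/-- The lengths of the concatenations of the nonempty prefixes of a list of lists. -/
def prefixLengths {α : Type*} (l : List (List α)) : List ℕ :=
  (List.range l.length).map fun a => (l.take (a + 1)).flatten.length

section

variable {α : Type*} (l : List (List α))

theorem length_prefixLengths : (prefixLengths l).length = l.length := by
  simp [prefixLengths]

theorem prefixLengths_append_singleton (s : List α) :
    prefixLengths (l ++ [s]) = prefixLengths l ++ [(l ++ [s]).flatten.length] := by
  simp only [prefixLengths, List.length_append, List.length_singleton, List.range_succ,
    List.map_append, List.map_singleton]
  congr 1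
  · refine List.map_congr_left fun a ha => ?_
    rw [List.take_append_of_le_length (List.mem_range.1 ha)]
  · rw [List.take_of_length_le (by simp)]

theorem getD_cons_prefixLengths (a : ℕ) :
    (0 :: prefixLengths l).getD a 0 = if a ≤ l.length then (l.take a).flatten.length else 0 := by
  cases a with
  | zero => simp
  | succ a =>
    rw [List.getD_cons_succ]
    split
    · next h =>
      rw [List.getD_eq_getElem _ _ (by rwa [length_prefixLengths])]
      simp [prefixLengths]
    · next h => exact List.getD_eq_default _ _ (by rw [length_prefixLengths]; omega)

end

/-- The partial output that consists of the complete groups `D`, the complete strings `S` of the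
next group and the letters `l` of the next string. -/
def Acc.of (D : Data) (S : List (List ℕ)) (l : List ℕ) : Acc where
  ltr := letters D ++ S.flatten ++ l
  str := prefixLengths (D.flatten ++ S)
  grp := prefixLengths D

section

variable (L : ℕ → ℕ) (D : Data) (S : List (List ℕ))

theorem Acc.run_letterTokens (l : List ℕ) (s : List Slot) :
    (Acc.of D S l).run L (letterTokens s) = Acc.of D S (l ++ s.map (Slot.inst L)) := by
  induction s generalizing l with
  | nil => simp [run, letterTokens]
  | cons c s ih =>
    have hpush : (Acc.of D S l).push L (.letter c) = Acc.of D S (l ++ [c.inst L]) := by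
      simp [push, Acc.of]
    calc (Acc.of D S l).run L (letterTokens (c :: s))
        = ((Acc.of D S l).push L (.letter c)).run L (letterTokens s) := rfl
      _ = Acc.of D S (l ++ (c :: s).map (Slot.inst L)) := by rw [hpush, ih]; simp

theorem Acc.run_stringTokens (s : List Slot) :
    (Acc.of D S []).run L (stringTokens s) = Acc.of D (S ++ [s.map (Slot.inst L)]) [] := by
  rw [stringTokens, run_append, run_letterTokens]
  simp [run, push, Acc.of, letters, ← List.append_assoc, prefixLengths_append_singleton]

theorem Acc.run_flatMap_stringTokens (g : List (List Slot)) :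
    (Acc.of D S []).run L (g.flatMap stringTokens) =
      Acc.of D (S ++ g.map fun s => s.map (Slot.inst L)) [] := by
  induction g generalizing S with
  | nil => simp [run]
  | cons s g ih => rw [List.flatMap_cons, run_append, run_stringTokens, ih]; simp

theorem Acc.run_groupTokens (g : List (List Slot)) :
    (Acc.of D [] []).run L (groupTokens g) =
      Acc.of (D ++ [g.map fun s => s.map (Slot.inst L)]) [] [] := by
  rw [groupTokens, run_append, run_flatMap_stringTokens]
  simp [run, push, Acc.of, letters, prefixLengths_append_singleton, length_prefixLengths]

theorem Acc.run_templateTokens (X : Template) :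
    (Acc.of D [] []).run L (templateTokens X) = Acc.of (D ++ X.inst L) [] [] := by
  induction X generalizing D with
  | nil => simp [run, templateTokens, Template.inst]
  | cons g X ih =>
    calc (Acc.of D [] []).run L (templateTokens (g :: X))
        = ((Acc.of D [] []).run L (groupTokens g)).run L (templateTokens X) := run_append ..
      _ = Acc.of (D ++ Template.inst L (g :: X)) [] [] := by
        rw [run_groupTokens, ih]; simp [Template.inst]

end

theorem Acc.mem_of (x : Data) : (Acc.of x [] []).mem = enc x := by
  funext b a
  match b with
  | 0 => simp [Acc.mem, enc, Acc.of]
  | 1 => simpa [Acc.mem, enc, Acc.of] using getD_cons_prefixLengths x.flatten a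
  | 2 => simpa [Acc.mem, enc, Acc.of] using getD_cons_prefixLengths x a
  | 3 => simp [Acc.mem, enc, Acc.of, length_prefixLengths]
  | b + 4 => rfl

theorem Acc.size_of (x : Data) :
    (Acc.of x [] []).size = x.length + x.flatten.length + (letters x).length := by
  simp only [size, Acc.of, length_prefixLengths, List.flatten_nil, List.append_nil]
  omega

theorem length_templateTokens (L : ℕ → ℕ) (X : Template) : (templateTokens X).length =
    (X.inst L).length + (X.inst L).flatten.length + (letters (X.inst L)).length := by
  have hrun := Acc.size_run L (Acc.of [] [] []) (templateTokens X)
  rw [Acc.run_templateTokens, List.nil_append, Acc.size_of, Acc.size_of] at hrun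
  simpa [letters] using hrun.symm

theorem dataSize_inst_le {M : ℕ} {X : Template} (L : ℕ → ℕ)
    (h : ∀ t ∈ templateTokens X, t.Below M) :
    dataSize (X.inst L) ≤ (templateTokens X).length + M + 2 := by
  have hmax : (letters (X.inst L)).foldr max 0 ≤ M := by
    refine List.max_le_of_forall_le _ M fun a ha => ?_
    simp only [letters_inst, List.mem_map, List.mem_flatten] at ha
    obtain ⟨c, ⟨s, ⟨g, hg, hs⟩, hc⟩, rfl⟩ := ha
    have hmem : Token.letter c ∈ templateTokens X := by
      simp only [templateTokens, groupTokens, stringTokens, letterTokens, List.mem_flatMap,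
        List.mem_append, List.mem_map]
      exact ⟨g, hg, .inl ⟨s, hs, .inl ⟨c, hc, rfl⟩⟩⟩
    have hc : c.yes < M ∧ c.no < M := h _ hmem
    rw [Slot.inst]
    split
    exacts [hc.2.le, hc.1.le]
  rw [dataSize, length_templateTokens L]
  omega

/-! ### Local maps from generators -/

/-- The number of strings in the first group of an input. -/
def order (x : Data) : ℕ := (x.take 1).flatten.length

/-- The map of inputs that is given by a template for each order. -/
def templateMap (X : ℕ → Template) (x : Data) : Data :=
  (X (order x)).inst fun p => (letters x).getD p 0

/-- On an input of order `n`, the generator puts out the template `X n`. -/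
def Gen.Describes (G : Gen) (X : ℕ → Template) : Prop :=
  ∀ n, G.tokens [n] = templateTokens (X n)

/-- The program of a generator that starts with the order of the input as its only variable. -/
def Gen.program (G : Gen) : Prog :=
  .seq (.store 5 (.const 0) (cell 2 1)) (G.compile 1)

theorem order_eq_of_shape_eq {x y : Data} (h : shape x = shape y) : order x = order y := by
  have horder : ∀ x : Data, order x = ((shape x).take 1).flatten.length := fun x => by
    cases x <;> simp [order, shape]
  rw [horder, horder, h]

theorem getD_letters_inst (L : ℕ → ℕ) (X : Template) (q : ℕ) :
    (letters (X.inst L)).getD q 0 = (X.flatten.flatten[q]?).elim 0 (Slot.inst L) := by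
  rw [letters_inst, List.getD_eq_getElem?_getD, List.getElem?_map]
  cases X.flatten.flatten[q]? <;> rfl

theorem isLocal_templateMap (X : ℕ → Template) : IsLocal (templateMap X) := by
  constructor
  · intro x y h
    rw [templateMap, templateMap, order_eq_of_shape_eq h]
    exact shape_inst ..
  · intro s q
    rcases em (∃ z, shape z = s) with ⟨z, rfl⟩ | hs
    · refine ⟨((X (order z)).flatten.flatten[q]?).elim 0 Slot.pos, fun x y hx hy h => ?_⟩
      rw [templateMap, templateMap, order_eq_of_shape_eq hx, order_eq_of_shape_eq hy,
        getD_letters_inst, getD_letters_inst]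
      cases hq : (X (order z)).flatten.flatten[q]? with
      | none => rfl
      | some c =>
        rw [hq] at h
        simp only [Option.elim] at h
        simp only [Option.elim, Slot.inst, h]
    · exact ⟨0, fun x _ hx => absurd ⟨x, hx⟩ hs⟩

theorem order_le_dataSize (x : Data) : order x ≤ dataSize x := by
  have hle : order x ≤ x.flatten.length := (List.take_sublist 1 x).flatten.length_le
  simp only [dataSize]
  omega

theorem two_le_dataSize (x : Data) : 2 ≤ dataSize x := Nat.le_add_left ..

theorem Fits.mono {κ κ' w : ℕ} (h : κ ≤ κ') {x : Data} (hx : Fits κ' w x) : Fits κ w x :=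
  (Nat.pow_le_pow_right (by have := two_le_dataSize x; omega) h).trans hx

theorem getD_order_le (x : Data) (v : ℕ) : [order x].getD v 0 ≤ dataSize x ^ 1 := by
  rw [pow_one]
  cases v with
  | zero => exact order_le_dataSize x
  | succ v => simp

theorem Gen.Invariant.of_enc (x : Data) :
    Invariant (fun p => (letters x).getD p 0) [] (Acc.of [] [] []) (enc x) where
  input _ := rfl
  vars v hv := by simp at hv
  out b a := by
    have hzero : enc x (6 + b) a = 0 := by rw [add_comm]; rfl
    rw [hzero, Acc.mem_of]
    rcases b with _ | _ | _ | _ | b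
    · simp [enc, letters]
    · simp [enc]
    · simp [enc]
    · rcases a with _ | _ | _ | a <;> rfl
    · rfl

theorem Gen.Describes.exec_program {G : Gen} {X : ℕ → Template} (hG : G.Describes X) :
    ∃ C κ : ℕ, ∀ x w, Fits κ w x → ∃ σ t, Exec w G.program (enc x) σ t ∧
      (∀ b a, σ (6 + b) a = enc (templateMap X x) b a) ∧ t ≤ C * G.work [order x] + 5 := by
  obtain ⟨C, hC⟩ := G.exists_compilesWithin 1
  obtain ⟨κ, hsafe, hlen, hκ⟩ := ((G.eventually_safe 1 1).and
    ((G.eventually_length_tokens_lt 1).and (Filter.eventually_ge_atTop 2))).exists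
  refine ⟨C, κ, fun x w hw => ?_⟩
  have h2 := two_le_dataSize x
  have h3 : 3 ≤ 2 ^ w := by
    have hsq : dataSize x ^ 2 ≤ 2 ^ w := hw.mono hκ
    nlinarith
  have horder : (cell 2 1).eval w (enc x) = order x := by
    rw [eval_cell (by omega)]
    cases x <;> simp [enc, order]
  obtain ⟨σ₁, e₁, i₁⟩ := exec_assign (Gen.Invariant.of_enc x) (cell 2 1) (Nat.two_pow_pos w)
  rw [horder, List.nil_append] at i₁
  have hspace : (Acc.of [] [] []).size + (G.tokens [order x]).length < 2 ^ w := by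
    simpa [Acc.size_of, letters] using (hlen _ _ h2 (getD_order_le x)).trans_le hw
  obtain ⟨σ₂, t, e₂, i₂, b₂⟩ :=
    hC rfl h3 ((hsafe _ _ h2 rfl (getD_order_le x)).mono hw) hspace i₁
  refine ⟨σ₂, _, .seq e₁ e₂, fun b a => ?_, ?_⟩
  · rw [i₂.out, hG, Acc.run_templateTokens, Acc.mem_of]
    rfl
  · simp only [cell, Expr.cost]
    omega

theorem Gen.Describes.exists_dataSize_le {G : Gen} {X : ℕ → Template} (hG : G.Describes X) :
    ∃ κ : ℕ, ∀ x, dataSize (templateMap X x) ≤ dataSize x ^ κ := by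
  obtain ⟨κ, hsafe, hlen⟩ := ((G.eventually_safe 1 1).and (G.eventually_length_tokens_lt 1)).exists
  refine ⟨2 + κ, fun x => ?_⟩
  have h2 := two_le_dataSize x
  have hbelow : ∀ t ∈ templateTokens (X (order x)), t.Below (dataSize x ^ κ) :=
    hG (order x) ▸ (hsafe _ _ h2 rfl (getD_order_le x)).below
  have hlt : (templateTokens (X (order x))).length < dataSize x ^ κ :=
    hG (order x) ▸ hlen _ _ h2 (getD_order_le x)
  calc dataSize (templateMap X x)
      ≤ (templateTokens (X (order x))).length + dataSize x ^ κ + 2 := dataSize_inst_le _ hbelow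
    _ ≤ 4 * dataSize x ^ κ := by omega
    _ ≤ dataSize x ^ 2 * dataSize x ^ κ := Nat.mul_le_mul_right _ (by nlinarith)
    _ = dataSize x ^ (2 + κ) := (pow_add ..).symm

/-! ### Running a program on the result of another one -/

theorem Expr.cost_shift (k : ℕ) (e : Expr) : (e.shift k).cost = e.cost := by
  induction e with
  | const c => rfl
  | load b e ih => simp only [Expr.shift, Expr.cost, ih]
  | bin o a b iha ihb => simp only [Expr.shift, Expr.cost, iha, ihb]

section

variable {w k : ℕ} {σ ρ : Mem}

theorem Expr.eval_shift (h : ∀ b a, ρ (k + b) a = σ b a) (e : Expr) :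
    (e.shift k).eval w ρ = e.eval w σ := by
  induction e with
  | const c => rfl
  | load b e ih => simp only [Expr.shift, Expr.eval, ih, h]
  | bin o a b iha ihb => simp only [Expr.shift, Expr.eval, iha, ihb]

theorem Exec.shift {M : Prog} {σ' : Mem} {t : ℕ} (hM : Exec w M σ σ' t)
    (h : ∀ b a, ρ (k + b) a = σ b a) :
    ∃ ρ', Exec w (M.shift k) ρ ρ' t ∧ ∀ b a, ρ' (k + b) a = σ' b a := by
  induction hM generalizing ρ with
  | skip σ => exact ⟨ρ, .skip ρ, h⟩
  | store σ b e₁ e₂ =>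
    have hstore := Exec.write (w := w) ρ (k + b) (e₁.shift k) (e₂.shift k)
    rw [Expr.cost_shift, Expr.cost_shift, Expr.eval_shift h, Expr.eval_shift h] at hstore
    refine ⟨_, hstore, fun b' a => ?_⟩
    rw [Mem.write_apply, ← Mem.write, Mem.write_apply, h]
    simp only [Nat.add_left_cancel_iff]
  | seq _ _ ih₁ ih₂ =>
    obtain ⟨ρ₁, e₁, h₁⟩ := ih₁ h
    obtain ⟨ρ₂, e₂, h₂⟩ := ih₂ h₁
    exact ⟨ρ₂, .seq e₁ e₂, h₂⟩
  | iteTrue hc _ ih =>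
    obtain ⟨ρ₁, e₁, h₁⟩ := ih h
    rw [← Expr.cost_shift k]
    exact ⟨ρ₁, .iteTrue (by rwa [Expr.eval_shift h]) e₁, h₁⟩
  | iteFalse hc _ ih =>
    obtain ⟨ρ₁, e₁, h₁⟩ := ih h
    rw [← Expr.cost_shift k]
    exact ⟨ρ₁, .iteFalse (by rwa [Expr.eval_shift h]) e₁, h₁⟩
  | whileTrue hc _ _ ih₁ ih₂ =>
    obtain ⟨ρ₁, e₁, h₁⟩ := ih₁ h
    obtain ⟨ρ₂, e₂, h₂⟩ := ih₂ h₁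
    rw [← Expr.cost_shift k]
    exact ⟨ρ₂, .whileTrue (by rwa [Expr.eval_shift h]) e₁ e₂, h₂⟩
  | whileFalse hc =>
    rw [← Expr.cost_shift k]
    exact ⟨ρ, .whileFalse (by rwa [Expr.eval_shift h]), h⟩

end

/-- The test in the loop of `disjunction`: it sets the answer if the last remaining bit is set. -/
def disjunctionTest (k : ℕ) : Prog :=
  .ite (.load (k + 4) (cell (k + 4) 0)) (.store 4 (.const 1) (.const 1)) .skip

/-- The step in the loop of `disjunction` to the next remaining bit. -/
def disjunctionStep (k : ℕ) : Prog :=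
  .store (k + 4) (.const 0) (.bin .sub (cell (k + 4) 0) (.const 1))

section

variable {w k n : ℕ} {σ : Mem}

theorem exec_disjunctionTest (hk : 1 ≤ k) (hw : 2 ≤ 2 ^ w) :
    ∃ σ' t, Exec w (disjunctionTest k) σ σ' t ∧ σ' 4 0 = σ 4 0 ∧ σ' (k + 4) = σ (k + 4) ∧
      (σ' 4 1 ≠ 0 ↔ σ 4 1 ≠ 0 ∨ σ (k + 4) (σ (k + 4) 0) ≠ 0) ∧ t ≤ 7 := by
  have hbit : (Expr.load (k + 4) (cell (k + 4) 0)).eval w σ = σ (k + 4) (σ (k + 4) 0) := by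
    rw [Expr.eval, eval_cell (by omega)]
  by_cases h0 : σ (k + 4) (σ (k + 4) 0) = 0
  · exact ⟨σ, _, .iteFalse (hbit.trans h0) (.skip σ), rfl, rfl, by simp [h0],
      by simp [cell, Expr.cost]⟩
  · refine ⟨_, _, .iteTrue (hbit.trans_ne h0) (exec_store_const (by omega) _), ?_, ?_, ?_,
      by simp [cell, Expr.cost]⟩
    · exact Mem.write_of_cell_ne (by decide)
    · exact funext fun a => Mem.write_of_bank_ne (by omega)
    · simp [Expr.eval, Nat.mod_eq_of_lt (show 1 < 2 ^ w by omega), h0]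

theorem exec_disjunctionStep (hw : 2 ≤ 2 ^ w) (hn : n + 1 < 2 ^ w) (h : σ (k + 4) 0 = n + 1) :
    Exec w (disjunctionStep k) σ (σ.write (k + 4) 0 n) 6 := by
  have hpred : (Expr.bin .sub (cell (k + 4) 0) (.const 1)).eval w σ = n := by
    rw [Expr.eval, eval_cell (by omega), h, Expr.eval, Nat.mod_eq_of_lt hw, Op.eval,
      show n + 1 + (2 ^ w - 1) = n + 2 ^ w by omega, Nat.add_mod_right,
      Nat.mod_eq_of_lt (by omega)]
  have hstore := exec_store_const (w := w) (σ := σ) (b := k + 4) (c := 0) (by omega)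
    (.bin .sub (cell (k + 4) 0) (.const 1))
  rwa [hpred] at hstore

theorem exec_disjunctionLoop (hk : 1 ≤ k) (hw : 2 ≤ 2 ^ w) (hn : n < 2 ^ w)
    (h : σ (k + 4) 0 = n) :
    ∃ σ' t, Exec w (.while (cell (k + 4) 0) (.seq (disjunctionTest k) (disjunctionStep k)))
      σ σ' t ∧ σ' 4 0 = σ 4 0 ∧ (σ' 4 1 ≠ 0 ↔ σ 4 1 ≠ 0 ∨ ∃ j < n, σ (k + 4) (j + 1) ≠ 0) ∧
      t ≤ 30 * n + 3 := by
  induction n generalizing σ with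
  | zero =>
    refine ⟨σ, _, .whileFalse ?_, rfl, by simp, by simp [cell, Expr.cost]⟩
    rw [eval_cell (by omega), h]
  | succ n ih =>
    obtain ⟨σ₁, t₁, e₁, hlen₁, hbank₁, hbit₁, ht₁⟩ := exec_disjunctionTest (σ := σ) hk hw
    have e₂ : Exec w (disjunctionStep k) σ₁ (σ₁.write (k + 4) 0 n) 6 :=
      exec_disjunctionStep hw hn (by rw [hbank₁, h])
    obtain ⟨σ₂, t₂, e₃, hlen₂, hbit₂, ht₂⟩ :=
      ih (σ := σ₁.write (k + 4) 0 n) (by omega) (Mem.write_self ..)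
    rw [Mem.write_of_bank_ne (by omega)] at hlen₂ hbit₂
    refine ⟨σ₂, _, .whileTrue ?_ (.seq e₁ e₂) e₃, hlen₂.trans hlen₁, ?_, ?_⟩
    · rw [eval_cell (by omega), h]
      exact Nat.succ_ne_zero n
    · have hunread : ∀ j, σ₁.write (k + 4) 0 n (k + 4) (j + 1) = σ (k + 4) (j + 1) := fun j => by
        rw [Mem.write_of_cell_ne (Nat.succ_ne_zero j), hbank₁]
      simp only [hbit₂, hbit₁, h, hunread, or_assoc, Nat.exists_lt_succ_right, or_comm]
    · simp only [cell, Expr.cost]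
      omega

end

theorem exec_disjunction {w k n : ℕ} {p : ℕ → Prop} {σ ρ : Mem} (hk : 5 ≤ k) (hw : 2 ≤ 2 ^ w)
    (hn : n < 2 ^ w) (hσ : Outputs σ n p) (h : ∀ b a, ρ (k + b) a = σ b a) :
    ∃ ρ' t, Exec w (disjunction k) ρ ρ' t ∧ Outputs ρ' 1 (fun _ => ∃ j < n, p j) ∧
      t ≤ 30 * n + 9 := by
  have hone : (Expr.const 1).eval w ρ = 1 := Nat.mod_eq_of_lt hw
  have hzero : (Expr.const 0).eval w (ρ.write 4 0 1) = 0 := Nat.zero_mod _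
  have e₁ : Exec w (.store 4 (.const 0) (.const 1)) ρ (ρ.write 4 0 1) 3 := by
    have hstore := exec_store_const (w := w) (σ := ρ) (b := 4) (c := 0) (by omega) (.const 1)
    rwa [hone] at hstore
  have e₂ : Exec w (.store 4 (.const 1) (.const 0)) (ρ.write 4 0 1)
      ((ρ.write 4 0 1).write 4 1 0) 3 := by
    have hstore := exec_store_const (w := w) (σ := ρ.write 4 0 1) (b := 4) (c := 1) hw (.const 0)
    rwa [hzero] at hstore
  have hbank : ∀ a, (ρ.write 4 0 1).write 4 1 0 (k + 4) a = σ 4 a := fun a => by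
    rw [Mem.write_of_bank_ne (by omega), Mem.write_of_bank_ne (by omega), h]
  obtain ⟨ρ', t, e₃, hlen, hbit, ht⟩ :=
    exec_disjunctionLoop (by omega) hw hn ((hbank 0).trans hσ.1)
  refine ⟨ρ', _, .seq e₁ (.seq e₂ e₃), ⟨?_, fun j hj => ?_⟩, by omega⟩
  · rw [hlen, Mem.write_of_cell_ne (by decide), Mem.write_self]
  · obtain rfl : j = 0 := by omega
    simp only [hbit, hbank, Mem.write_self, ne_eq, not_true_eq_false, false_or]
    exact exists_congr fun j => and_congr_right fun hj => hσ.2 j hj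

theorem Gen.Describes.exec_reduceTo {G : Gen} {X : ℕ → Template} (hG : G.Describes X) {M : Prog}
    {τ : ℕ → ℕ → ℕ → ℝ} (hM : SolvesEDSM M τ) :
    ∃ (C κ : ℕ) (K : ℝ), ∀ x P T, templateMap X x = [P] :: T → IsInstance P T →
      ∀ w, Fits κ w x → ∃ σ t, Exec w (reduceTo 6 G.program M) (enc x) σ t ∧
        Outputs σ 1 (fun _ => ∃ j < T.length, OccEndsAt P T j) ∧
        (t : ℝ) ≤ C * G.work [order x] + K * τ P.length T.length (textSize T)
          + 30 * T.length + 14 := by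
  obtain ⟨C, κ₁, hprogram⟩ := hG.exec_program
  obtain ⟨κ₂, hsize⟩ := hG.exists_dataSize_le
  obtain ⟨K, κ₃, hsolves⟩ := hM
  refine ⟨C, κ₁ + κ₂ * (κ₃ + 1), K, fun x P T hx hP w hw => ?_⟩
  have hfit : Fits (κ₃ + 1) w ([P] :: T) :=
    calc dataSize ([P] :: T) ^ (κ₃ + 1) = dataSize (templateMap X x) ^ (κ₃ + 1) := by rw [hx]
      _ ≤ (dataSize x ^ κ₂) ^ (κ₃ + 1) := Nat.pow_le_pow_left (hsize x) _
      _ = dataSize x ^ (κ₂ * (κ₃ + 1)) := (pow_mul ..).symm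
      _ ≤ 2 ^ w := hw.mono (Nat.le_add_left _ _)
  have hfit₁ : dataSize ([P] :: T) ≤ 2 ^ w :=
    (Nat.le_self_pow (Nat.succ_ne_zero κ₃) _).trans hfit
  have hT : T.length < dataSize ([P] :: T) := by
    simp only [dataSize, List.length_cons]
    omega
  obtain ⟨σ₁, t₁, e₁, henc, b₁⟩ := hprogram x w (hw.mono (by omega))
  obtain ⟨σ₂, t₂, e₂, hout, b₂⟩ := hsolves P T hP w (hfit.mono (Nat.le_succ κ₃))
  obtain ⟨ρ, e₂', hρ⟩ := e₂.shift (k := 6) (ρ := σ₁) fun b a => by rw [henc, hx]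
  obtain ⟨ρ', t₃, e₃, hor, b₃⟩ := exec_disjunction (k := 6) (by omega)
    ((two_le_dataSize _).trans hfit₁) (hT.trans_le hfit₁) hout hρ
  refine ⟨ρ', _, .seq e₁ (.seq e₂' e₃), hor, ?_⟩
  have b₁' : (t₁ : ℝ) ≤ C * G.work [order x] + 5 := by exact_mod_cast b₁
  have b₃' : (t₃ : ℝ) ≤ 30 * T.length + 9 := by exact_mod_cast b₃
  push_cast
  linarith

/-! ### Spelling a string by a sequence of segments -/

/-- The string is a concatenation of strings of the segments, one from each. -/
def Spells {α : Type*} : List (List (List α)) → List α → Prop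
  | [], p => p = []
  | R :: Y, p => ∃ a ∈ R, ∃ c, p = a ++ c ∧ Spells Y c

section

variable {α : Type*} {X Y Y' : List (List (List α))} {p : List α} {x y : α}

theorem spells_iff : Spells Y p ↔ ∃ qs, List.Forall₂ (fun q R => q ∈ R) qs Y ∧ p = qs.flatten := by
  induction Y generalizing p with
  | nil => simp [Spells]
  | cons R Y ih =>
    simp only [Spells, List.forall₂_cons_right_iff, ih]
    constructor
    · rintro ⟨a, ha, c, rfl, qs, hqs, rfl⟩
      exact ⟨_, ⟨a, qs, ha, hqs, rfl⟩, rfl⟩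
    · rintro ⟨_, ⟨a, qs, ha, hqs, rfl⟩, rfl⟩
      exact ⟨a, ha, _, rfl, qs, hqs, rfl⟩

theorem spells_append :
    Spells (Y ++ Y') p ↔ ∃ a c, p = a ++ c ∧ Spells Y a ∧ Spells Y' c := by
  induction Y generalizing p with
  | nil => simp [Spells]
  | cons R Y ih =>
    simp only [List.cons_append, Spells, ih]
    constructor
    · rintro ⟨a, ha, _, rfl, c, d, rfl, hc, hd⟩
      exact ⟨a ++ c, d, by simp, ⟨a, ha, c, rfl, hc⟩, hd⟩
    · rintro ⟨_, d, rfl, ⟨a, ha, c, rfl, hc⟩, hd⟩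
      exact ⟨a, ha, c ++ d, by simp, c, d, rfl, hc, hd⟩

theorem Matches.exists_mem_head? (h : Matches (x :: p) X) :
    ∃ S ∈ X.head?, ∃ u ∈ S, x ∈ u := by
  obtain ⟨S, rfl, u, hu, hpu⟩ | ⟨S, Y, S', rfl, a, qs, c, hp, ha, -, ⟨u, hu, hau⟩, -⟩ := h
  · exact ⟨S, rfl, u, hu, hpu.subset List.mem_cons_self⟩
  · obtain ⟨z, a, rfl⟩ := List.exists_cons_of_ne_nil ha
    obtain ⟨rfl, -⟩ := List.cons_eq_cons.1 hp
    exact ⟨S, rfl, u, hu, hau.subset List.mem_cons_self⟩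

theorem Matches.exists_mem_getLast? (h : Matches (p ++ [y]) X) :
    ∃ S ∈ X.getLast?, ∃ u ∈ S, y ∈ u := by
  obtain ⟨S, rfl, u, hu, hpu⟩ | ⟨S, Y, S', rfl, a, qs, c, hp, -, hc, -, -, ⟨u, hu, hcu⟩⟩ := h
  · exact ⟨S, rfl, u, hu, hpu.subset (List.mem_append_right _ List.mem_cons_self)⟩
  · have hy : c.getLast? = some y := by
      rw [← List.getLast?_append_of_ne_nil _ hc, ← hp, List.getLast?_concat]
    exact ⟨S', by rw [← List.cons_append, List.getLast?_concat]; rfl, u, hu,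
      hcu.subset (List.mem_of_getLast? hy)⟩

theorem matches_delimited_iff :
    Matches (x :: (p ++ [y])) ([[x]] :: (Y ++ [[[y]]])) ↔ Spells Y p := by
  rw [spells_iff]
  constructor
  · rintro (⟨S, hS, -⟩ | ⟨S, Y', S', hX, a, qs, c, hp, ha, hc, ⟨u, hu, hau⟩, hqs, ⟨v, hv, hcv⟩⟩)
    · simp at hS
    · obtain ⟨rfl, hX'⟩ := List.cons_eq_cons.1 hX
      obtain ⟨rfl, hS'⟩ := List.append_inj' hX' rfl
      obtain rfl := List.singleton_injective hS'
      obtain rfl := List.mem_singleton.1 hu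
      obtain rfl := List.mem_singleton.1 hv
      obtain rfl : a = [x] :=
        (List.suffix_cons_iff.1 hau).resolve_right fun h => ha (List.suffix_nil.1 h)
      obtain ⟨z, c, rfl⟩ := List.exists_cons_of_ne_nil hc
      obtain ⟨rfl, hnil⟩ := List.cons_prefix_cons.1 hcv
      obtain rfl := List.prefix_nil.1 hnil
      exact ⟨qs, hqs, List.append_cancel_right (List.cons_eq_cons.1 hp).2⟩
  · rintro ⟨qs, hqs, rfl⟩
    exact .inr ⟨[[x]], Y, [[y]], rfl, [x], qs, [y], rfl, List.cons_ne_nil _ _, List.cons_ne_nil _ _,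
      ⟨[x], List.mem_singleton_self _, List.suffix_rfl⟩, hqs,
      ⟨[y], List.mem_singleton_self _, List.prefix_rfl⟩⟩

/-- The unique letters at the two ends of the pattern pin an occurrence to the whole text. -/
theorem exists_occEndsAt_delimited_iff (hxy : x ≠ y) (hx : ∀ R ∈ Y, ∀ u ∈ R, x ∉ u)
    (hy : ∀ R ∈ Y, ∀ u ∈ R, y ∉ u) :
    (∃ j < ([[x]] :: (Y ++ [[[y]]])).length,
      OccEndsAt (x :: (p ++ [y])) ([[x]] :: (Y ++ [[[y]]])) j) ↔ Spells Y p := by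
  rw [← matches_delimited_iff (x := x) (y := y)]
  have htail : ∀ R ∈ Y ++ [[[y]]], ∀ u ∈ R, x ∉ u := by
    simpa [or_imp, forall_and, hxy] using hx
  have hinit : ∀ R ∈ [[x]] :: Y, ∀ u ∈ R, y ∉ u := by
    simpa [hxy.symm] using hy
  constructor
  · rintro ⟨j, hj, -, i, hij, h⟩
    obtain rfl : i = 0 := by
      obtain ⟨S, hS, u, hu, hxu⟩ := h.exists_mem_head?
      by_contra hi
      obtain ⟨i, rfl⟩ := Nat.exists_eq_succ_of_ne_zero hi
      rw [List.take_succ_cons, List.drop_succ_cons] at hS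
      exact htail S (List.mem_of_mem_take (List.mem_of_mem_drop (List.mem_of_mem_head? hS)))
        u hu hxu
    rw [List.drop_zero] at h
    have hlen : j + 1 = ([[x]] :: (Y ++ [[[y]]])).length := by
      obtain ⟨S, hS, u, hu, hyu⟩ := Matches.exists_mem_getLast? (p := x :: p) h
      by_contra hne
      simp only [List.length_cons, List.length_append, List.length_nil] at hj hne
      rw [← List.cons_append, List.take_append_of_le_length (by simp; omega)] at hS
      exact hinit S (List.mem_of_mem_take (List.mem_of_getLast? hS)) u hu hyu
    rwa [hlen, List.take_length] at h
  · intro h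
    refine ⟨Y.length + 1, by simp, by simp, 0, Nat.zero_le _, ?_⟩
    rwa [List.drop_zero, List.take_of_length_le (by simp)]

end

/-! ### The pattern and the segments that skip parts of it -/

/-- The `z`-th piece of the pattern. For `z = (i * r + c) * r + d` with `c, d < r` it stands for the
`i`-th row and the `c`-th and the `d`-th block of `b` columns. Modulo 4, its separators are 1, 2
and 3. -/
def piece (r b z : ℕ) : List ℕ :=
  (4 * (z / r) + 1) :: (List.replicate b 0 ++ (4 * (z % (r * r)) + 2) ::
    (List.replicate b 0 ++ [4 * (z / (r * r) * r + z % r) + 3]))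

/-- The `n` consecutive pieces from the `a`-th one on. -/
def pieces (r b a n : ℕ) : List ℕ := (List.range' a n).flatMap (piece r b)

/-- The pattern: all `Z` pieces, between two letters that occur nowhere else. -/
def pattern (r b Z : ℕ) : List ℕ := 4 :: (pieces r b 0 Z ++ [8])

/-- A segment by which any of the `r ^ (D - t)` blocks of `r ^ t` consecutive pieces, or none, can
be skipped. -/
def skipSegment (r b D t : ℕ) : List (List ℕ) :=
  [] :: (List.range (r ^ (D - t))).map fun c => pieces r b (c * r ^ t) (r ^ t)

/-- The segments by which an initial part of fewer than `r ^ t` pieces is skipped: its length is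
expanded in base `r`, and there are `r` segments for each digit. The same segments in reverse order
skip a final part. -/
def skipSegments (r b D : ℕ) : ℕ → List (List (List ℕ))
  | 0 => []
  | t + 1 => List.replicate r (skipSegment r b D t) ++ skipSegments r b D t

theorem replicate_append_cons_inj {α : Type*} {o x y : α} {m n : ℕ} {s t : List α} (hx : x ≠ o)
    (hy : y ≠ o) (h : List.replicate m o ++ x :: s = List.replicate n o ++ y :: t) :
    m = n ∧ x = y ∧ s = t := by
  induction m generalizing n with
  | zero =>
    cases n with
    | zero => simpa using h
    | succ n => simp [List.replicate_succ, hx] at h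
  | succ m ih =>
    cases n with
    | zero => simp [List.replicate_succ, hy.symm] at h
    | succ n =>
      simp only [List.replicate_succ, List.cons_append, List.cons.injEq, true_and] at h
      simpa using ih h

theorem mul_add_inj {r a c a' c' : ℕ} (hc : c < r) (hc' : c' < r)
    (h : a * r + c = a' * r + c') : a = a' ∧ c = c' := by
  have hdivMod : ∀ a, ∀ c < r, (a * r + c) / r = a ∧ (a * r + c) % r = c := fun a c hc =>
    (Nat.div_mod_unique (Nat.zero_lt_of_lt hc)).2 ⟨by ring, hc⟩
  have hac := h ▸ hdivMod a c hc
  have hac' := hdivMod a' c' hc'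
  exact ⟨hac.1.symm.trans hac'.1, hac.2.symm.trans hac'.2⟩

section

variable {r b : ℕ}

theorem exists_eq_mul_add_mul_add (hr : 0 < r) (z : ℕ) :
    ∃ i c d, c < r ∧ d < r ∧ z = (i * r + c) * r + d :=
  ⟨z / r / r, z / r % r, z % r, Nat.mod_lt _ hr, Nat.mod_lt _ hr, by
    rw [Nat.div_add_mod', Nat.div_add_mod']⟩

theorem piece_mul_add_mul_add {i c d : ℕ} (hc : c < r) (hd : d < r) :
    piece r b ((i * r + c) * r + d) = (4 * (i * r + c) + 1) :: (List.replicate b 0 ++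
      (4 * (c * r + d) + 2) :: (List.replicate b 0 ++ [4 * (i * r + d) + 3])) := by
  have hr : 0 < r := Nat.zero_lt_of_lt hc
  have hdiv : ((i * r + c) * r + d) / r = i * r + c := by
    rw [mul_comm, Nat.mul_add_div hr, Nat.div_eq_of_lt hd, add_zero]
  have hmod : ((i * r + c) * r + d) % r = d := by
    rw [Nat.mul_add_mod', Nat.mod_eq_of_lt hd]
  have hdiv_sq : ((i * r + c) * r + d) / (r * r) = i := by
    rw [← Nat.div_div_eq_div_mul, hdiv, mul_comm, Nat.mul_add_div hr, Nat.div_eq_of_lt hc,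
      add_zero]
  have hmod_sq : ((i * r + c) * r + d) % (r * r) = c * r + d := by
    rw [Nat.mod_mul, hmod, hdiv, Nat.mul_add_mod', Nat.mod_eq_of_lt hc, add_comm, mul_comm]
  rw [piece, hdiv, hmod, hdiv_sq, hmod_sq]

theorem piece_injective : Function.Injective (piece r b) := fun z z' h => by
  simp only [piece, List.cons.injEq] at h
  obtain ⟨hdiv, h⟩ := h
  obtain ⟨-, hmod_sq, -⟩ := replicate_append_cons_inj (by omega) (by omega) h
  refine Nat.ext_div_mod (n := r) (by omega) ?_
  rw [← Nat.mod_mul_left_mod z r r, ← Nat.mod_mul_left_mod z' r r,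
    show z % (r * r) = z' % (r * r) by omega]

theorem length_piece (z : ℕ) : (piece r b z).length = 2 * b + 3 := by
  simp only [piece, List.length_cons, List.length_append, List.length_replicate, List.length_nil]
  omega

theorem pieces_one (a : ℕ) : pieces r b a 1 = piece r b a := List.flatMap_singleton ..

theorem pieces_add (a n n' : ℕ) :
    pieces r b a (n + n') = pieces r b a n ++ pieces r b (a + n) n' := by
  rw [pieces, pieces, pieces, ← List.flatMap_append, List.range'_append_1]

theorem length_pieces (a n : ℕ) : (pieces r b a n).length = n * (2 * b + 3) := by
  simp [pieces, List.length_flatMap, length_piece]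

theorem length_pattern (Z : ℕ) : (pattern r b Z).length = Z * (2 * b + 3) + 2 := by
  simp [pattern, length_pieces]

theorem pieces_injective {n : ℕ} (hn : 0 < n) : Function.Injective (pieces r b · n) :=
  fun a a' h => by
    obtain ⟨n, rfl⟩ := Nat.exists_eq_add_of_lt hn
    simp only [Nat.zero_add, Nat.add_comm n 1, pieces_add, pieces_one] at h
    exact piece_injective (List.append_inj_left h (by simp only [length_piece]))

theorem exists_flatMap_piece_of_append {zs ws s : List ℕ}
    (h : zs.flatMap (piece r b) ++ s = ws.flatMap (piece r b)) :
    ∃ ws' : List ℕ, s = ws'.flatMap (piece r b) := by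
  induction zs generalizing ws with
  | nil => exact ⟨ws, h⟩
  | cons z zs ih =>
    cases ws with
    | nil => simp [piece] at h
    | cons w ws =>
      simp only [List.flatMap_cons, List.append_assoc] at h
      exact ih (List.append_inj_right h (by simp only [length_piece]))

theorem Spells.exists_flatMap_piece {Y : List (List (List ℕ))} {p : List ℕ} (h : Spells Y p)
    (hY : ∀ R ∈ Y, ∀ u ∈ R, ∃ zs : List ℕ, u = zs.flatMap (piece r b)) :
    ∃ zs : List ℕ, p = zs.flatMap (piece r b) := by
  induction Y generalizing p with
  | nil => exact ⟨[], h⟩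
  | cons R Y ih =>
    obtain ⟨a, ha, c, rfl, hc⟩ := h
    obtain ⟨zs, rfl⟩ := hY R List.mem_cons_self a ha
    obtain ⟨zs', rfl⟩ := ih hc fun R hR => hY R (List.mem_cons_of_mem _ hR)
    exact ⟨zs ++ zs', List.flatMap_append.symm⟩

variable {D t : ℕ}

theorem exists_flatMap_piece_of_mem_skipSegment {u : List ℕ} (h : u ∈ skipSegment r b D t) :
    ∃ zs : List ℕ, u = zs.flatMap (piece r b) := by
  simp only [skipSegment, List.mem_cons, List.mem_map] at h
  obtain rfl | ⟨c, -, rfl⟩ := h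
  · exact ⟨[], rfl⟩
  · exact ⟨_, rfl⟩

theorem nodup_skipSegment (hr : 0 < r) : (skipSegment r b D t).Nodup := by
  have hpos : 0 < r ^ t := Nat.pow_pos hr
  refine List.nodup_cons.2 ⟨?_, List.nodup_range.map fun c c' h =>
    Nat.eq_of_mul_eq_mul_right hpos (pieces_injective hpos h)⟩
  simp only [List.mem_map, not_exists, not_and, ← List.length_eq_zero_iff, length_pieces]
  intro c _
  positivity

theorem length_flatten_skipSegment :
    (skipSegment r b D t).flatten.length = r ^ (D - t) * (r ^ t * (2 * b + 3)) := by
  simp [skipSegment, List.length_flatten, Function.comp_def, length_pieces]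

theorem exists_eq_skipSegment_of_mem {R : List (List ℕ)} (h : R ∈ skipSegments r b D t) :
    ∃ s, R = skipSegment r b D s := by
  induction t with
  | zero => simp [skipSegments] at h
  | succ t ih => exact (List.mem_append.1 h).elim (fun h => ⟨t, List.eq_of_mem_replicate h⟩) ih

theorem skipSegment_zero_mem_skipSegments (hr : r ≠ 0) (ht : t ≠ 0) :
    skipSegment r b D 0 ∈ skipSegments r b D t := by
  induction t with
  | zero => exact absurd rfl ht
  | succ t ih =>
    rcases eq_or_ne t 0 with rfl | h
    · exact List.mem_append_left _ (List.mem_replicate.2 ⟨hr, rfl⟩)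
    · exact List.mem_append_right _ (ih h)

theorem length_skipSegments : (skipSegments r b D t).length = t * r := by
  induction t with
  | zero => simp [skipSegments]
  | succ t ih => rw [skipSegments, List.length_append, List.length_replicate, ih]; ring

theorem reverse_skipSegments_succ : (skipSegments r b D (t + 1)).reverse =
    (skipSegments r b D t).reverse ++ List.replicate r (skipSegment r b D t) := by
  rw [skipSegments, List.reverse_append, List.reverse_replicate]

theorem pieces_mem_skipSegment (ht : t ≤ D) (hr : 0 < r) {e : ℕ} (h : (e + 1) * r ^ t ≤ r ^ D) :
    pieces r b (e * r ^ t) (r ^ t) ∈ skipSegment r b D t := by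
  rw [← Nat.sub_add_cancel ht, pow_add] at h
  exact List.mem_cons_of_mem _ (List.mem_map.2
    ⟨e, List.mem_range.2 (Nat.le_of_mul_le_mul_right h (Nat.pow_pos hr)), rfl⟩)

theorem spells_replicate_skipSegment (ht : t ≤ D) (hr : 0 < r) {k d e : ℕ} (hd : d ≤ k)
    (h : (e + d) * r ^ t ≤ r ^ D) :
    Spells (List.replicate k (skipSegment r b D t)) (pieces r b (e * r ^ t) (d * r ^ t)) := by
  induction k generalizing d e with
  | zero =>
    obtain rfl := Nat.le_zero.1 hd
    rw [Nat.zero_mul]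
    rfl
  | succ k ih =>
    cases d with
    | zero => exact ⟨[], List.mem_cons_self, _, rfl, ih (Nat.zero_le k) h⟩
    | succ d =>
      refine ⟨_, pieces_mem_skipSegment ht hr (e := e) (le_trans (by gcongr; omega) h),
        pieces r b ((e + 1) * r ^ t) (d * r ^ t), ?_,
        ih (Nat.le_of_succ_le_succ hd) (by rwa [add_assoc, add_comm 1])⟩
      rw [Nat.succ_mul, Nat.add_comm, pieces_add, ← Nat.succ_mul]

theorem spells_skipSegments (ht : t ≤ D) (hr : 0 < r) {e n : ℕ} (hn : n < r ^ t)
    (h : (e + 1) * r ^ t ≤ r ^ D) : Spells (skipSegments r b D t) (pieces r b (e * r ^ t) n) := by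
  induction t generalizing e n with
  | zero =>
    obtain rfl : n = 0 := by simpa using hn
    rfl
  | succ t ih =>
    have hd : n / r ^ t < r := Nat.div_lt_of_lt_mul (by rwa [pow_succ] at hn)
    have hle : (e * r + n / r ^ t + 1) * r ^ t ≤ r ^ D :=
      calc (e * r + n / r ^ t + 1) * r ^ t ≤ ((e + 1) * r) * r ^ t :=
            Nat.mul_le_mul_right _ (by rw [Nat.succ_mul]; omega)
        _ = (e + 1) * r ^ (t + 1) := by rw [mul_assoc, ← pow_succ']
        _ ≤ r ^ D := h
    rw [skipSegments, spells_append]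
    refine ⟨pieces r b (e * r * r ^ t) (n / r ^ t * r ^ t),
      pieces r b ((e * r + n / r ^ t) * r ^ t) (n % r ^ t), ?_,
      spells_replicate_skipSegment (by omega) hr hd.le
        ((Nat.mul_le_mul_right _ (Nat.le_succ _)).trans hle),
      ih (by omega) (Nat.mod_lt _ (Nat.pow_pos hr)) hle⟩
    rw [add_mul, ← pieces_add, Nat.div_add_mod', mul_assoc, ← pow_succ']

theorem spells_reverse_skipSegments (ht : t ≤ D) (hr : 0 < r) {e a n : ℕ} (hn : n < r ^ t)
    (ha : a + n = (e + 1) * r ^ t) (h : (e + 1) * r ^ t ≤ r ^ D) :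
    Spells (skipSegments r b D t).reverse (pieces r b a n) := by
  induction t generalizing e a n with
  | zero =>
    obtain rfl : n = 0 := by simpa using hn
    rfl
  | succ t ih =>
    have hd : n / r ^ t < r := Nat.div_lt_of_lt_mul (by rwa [pow_succ] at hn)
    obtain ⟨e', he'⟩ : ∃ e', e' + 1 + n / r ^ t = (e + 1) * r :=
      ⟨(e + 1) * r - n / r ^ t - 1, by
        have : r ≤ (e + 1) * r := Nat.le_mul_of_pos_left _ (Nat.succ_pos e)
        omega⟩
    have hsplit : (e' + 1) * r ^ t + n / r ^ t * r ^ t = (e + 1) * r ^ (t + 1) := by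
      rw [← add_mul, he', mul_assoc, ← pow_succ']
    have hn' := Nat.div_add_mod' n (r ^ t)
    rw [reverse_skipSegments_succ, spells_append]
    refine ⟨pieces r b a (n % r ^ t), pieces r b ((e' + 1) * r ^ t) (n / r ^ t * r ^ t), ?_,
      ih (by omega) (e := e') (Nat.mod_lt _ (Nat.pow_pos hr)) (by omega) (by omega),
      spells_replicate_skipSegment (by omega) hr hd.le (by rw [add_mul]; omega)⟩
    rw [show (e' + 1) * r ^ t = a + n % r ^ t by omega, ← pieces_add, add_comm, hn']

end

/-! ### The segments of the matrices -/

/-- A segment with a string for every entry of an `m × m` matrix. -/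
def grid {α : Type*} (m : ℕ) (g : ℕ → ℕ → α) : List α :=
  (List.range m ×ˢ List.range m).map fun e => g e.1 e.2

section

variable {α β : Type*} {m : ℕ} {g : ℕ → ℕ → α}

theorem mem_grid {s : α} : s ∈ grid m g ↔ ∃ i < m, ∃ j < m, g i j = s := by
  simp [grid, and_assoc]

theorem map_grid (f : α → β) : (grid m g).map f = grid m fun i j => f (g i j) := List.map_map

theorem nodup_grid (h : ∀ i < m, ∀ j < m, ∀ i' < m, ∀ j' < m, g i j = g i' j' → i = i' ∧ j = j') :
    (grid m g).Nodup := by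
  refine (List.nodup_range.product List.nodup_range).map_on ?_
  rintro ⟨i, j⟩ hij ⟨i', j'⟩ hij' he
  obtain ⟨hi, hj⟩ := List.pair_mem_product.1 hij
  obtain ⟨hi', hj'⟩ := List.pair_mem_product.1 hij'
  exact Prod.ext_iff.2 (h i (List.mem_range.1 hi) j (List.mem_range.1 hj)
    i' (List.mem_range.1 hi') j' (List.mem_range.1 hj') he)

end

/-- A separator that carries `v` and, if `a` is nonzero, the remainder `tag` modulo 4. For `a = 0`
it is a multiple of 4, so that it does not occur in any piece, and different from 4 and 8. -/
def mark (a v tag : ℕ) : ℕ := if a = 0 then 4 * v + 12 else 4 * v + tag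

/-- The string of entry `i`, `j` of the first matrix. -/
def leftString (r b : ℕ) (A : ℕ → ℕ → ℕ) (i j : ℕ) : List ℕ :=
  mark (A i j) (i * r + j / b) 1 :: List.replicate (j % b) 0

/-- The string of entry `j`, `k` of the second matrix. -/
def midString (r b : ℕ) (B : ℕ → ℕ → ℕ) (j k : ℕ) : List ℕ :=
  List.replicate (b - j % b) 0 ++ mark (B j k) (j / b * r + k / b) 2 :: List.replicate (k % b) 0

/-- The string of entry `k`, `i` of the third matrix. -/
def rightString (r b : ℕ) (C : ℕ → ℕ → ℕ) (k i : ℕ) : List ℕ :=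
  List.replicate (b - k % b) 0 ++ [mark (C k i) (i * r + k / b) 3]

/-- The three segments of the matrices. -/
def matrixSegments (r b m : ℕ) (A B C : ℕ → ℕ → ℕ) : List (List (List ℕ)) :=
  [grid m (leftString r b A), grid m (midString r b B), grid m (rightString r b C)]

/-- The segments of the text between its two ends. -/
def core (r b m D : ℕ) (A B C : ℕ → ℕ → ℕ) : List (List (List ℕ)) :=
  skipSegments r b D D ++ (matrixSegments r b m A B C ++ (skipSegments r b D D).reverse)

/-- The text, which starts and ends with the first and the last letter of the pattern. -/
def text (r b m D : ℕ) (A B C : ℕ → ℕ → ℕ) : Data := [[4]] :: (core r b m D A B C ++ [[[8]]])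

/-- The tripartite graph with adjacency matrices `A`, `B` and `C` of order `m` has a triangle. -/
def HasTriangle (m : ℕ) (A B C : ℕ → ℕ → ℕ) : Prop :=
  ∃ i < m, ∃ j < m, ∃ k < m, A i j ≠ 0 ∧ B j k ≠ 0 ∧ C k i ≠ 0

section

variable {a v tag a' v' : ℕ}

theorem mark_ne_zero (h : 0 < tag) : mark a v tag ≠ 0 := by
  unfold mark; split <;> omega

theorem ne_zero_and_eq_of_mark_eq (h : 0 < tag) (h' : tag < 4) (he : mark a v tag = 4 * v' + tag) :
    a ≠ 0 ∧ v = v' := by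
  unfold mark at he; split at he <;> omega

theorem eq_of_mark_eq_mark (h : 0 < tag) (h' : tag < 4) (he : mark a v tag = mark a' v' tag) :
    v = v' := by
  unfold mark at he; split at he <;> split at he <;> omega

end

section

variable {r b : ℕ} {A B C : ℕ → ℕ → ℕ}

theorem leftString_inj {i j i' j' : ℕ} (hj : j / b < r) (hj' : j' / b < r)
    (h : leftString r b A i j = leftString r b A i' j') : i = i' ∧ j = j' := by
  obtain ⟨hmark, hrest⟩ := List.cons_eq_cons.1 h
  obtain ⟨hi, hdiv⟩ := mul_add_inj hj hj' (eq_of_mark_eq_mark one_pos (by decide) hmark)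
  exact ⟨hi, Nat.ext_div_mod hdiv (List.replicate_left_injective 0 hrest)⟩

variable (hb : 0 < b)
include hb

theorem midString_inj {j k j' k' : ℕ} (hk : k / b < r) (hk' : k' / b < r)
    (h : midString r b B j k = midString r b B j' k') : j = j' ∧ k = k' := by
  obtain ⟨hsub, hmark, hrest⟩ := replicate_append_cons_inj (mark_ne_zero two_pos)
    (mark_ne_zero two_pos) h
  obtain ⟨hdiv, hdiv'⟩ := mul_add_inj hk hk' (eq_of_mark_eq_mark two_pos (by decide) hmark)
  have hj := Nat.mod_lt j hb
  have hj' := Nat.mod_lt j' hb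
  exact ⟨Nat.ext_div_mod hdiv (by omega),
    Nat.ext_div_mod hdiv' (List.replicate_left_injective 0 hrest)⟩

theorem rightString_inj {k i k' i' : ℕ} (hk : k / b < r) (hk' : k' / b < r)
    (h : rightString r b C k i = rightString r b C k' i') : k = k' ∧ i = i' := by
  obtain ⟨hsub, hmark, -⟩ := replicate_append_cons_inj (mark_ne_zero three_pos)
    (mark_ne_zero three_pos) h
  obtain ⟨hi, hdiv⟩ := mul_add_inj hk hk' (eq_of_mark_eq_mark three_pos (by decide) hmark)
  have hk := Nat.mod_lt k hb
  have hk' := Nat.mod_lt k' hb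
  exact ⟨Nat.ext_div_mod hdiv (by omega), hi⟩

theorem append_eq_piece {i j k : ℕ} (hj : j / b < r) (hk : k / b < r) (hA : A i j ≠ 0)
    (hB : B j k ≠ 0) (hC : C k i ≠ 0) :
    leftString r b A i j ++ (midString r b B j k ++ rightString r b C k i) =
      piece r b ((i * r + j / b) * r + k / b) := by
  have hzeros : ∀ c, List.replicate b 0 =
      List.replicate (c % b) 0 ++ List.replicate (b - c % b) 0 := fun c => by
    rw [List.replicate_append_replicate, Nat.add_sub_cancel' (Nat.mod_lt c hb).le]
  rw [piece_mul_add_mul_add hj hk]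
  nth_rewrite 1 [hzeros j]
  rw [hzeros k]
  simp only [leftString, midString, rightString, mark, hA, hB, hC, if_false, List.cons_append,
    List.append_assoc]

/-- The runs of zeros between the separators have the length `b` only if the columns of one string
are the rows of the next. -/
theorem triangle_of_append_eq_piece_append {i j j' k k' i' z : ℕ} {s s' : List ℕ} (hj : j / b < r)
    (hk : k / b < r) (hk' : k' / b < r)
    (h : leftString r b A i j ++ (midString r b B j' k ++ (rightString r b C k' i' ++ s)) =
      piece r b z ++ s') :
    i = i' ∧ j = j' ∧ k = k' ∧ A i j ≠ 0 ∧ B j k ≠ 0 ∧ C k i ≠ 0 := by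
  obtain ⟨i₀, c, d, hc, hd, rfl⟩ := exists_eq_mul_add_mul_add (Nat.zero_lt_of_lt hj) z
  simp only [piece_mul_add_mul_add hc hd, leftString, midString, rightString, List.cons_append,
    List.append_assoc, List.nil_append] at h
  obtain ⟨hleft, h⟩ := List.cons_eq_cons.1 h
  rw [← List.append_assoc, List.replicate_append_replicate] at h
  obtain ⟨hjj', hmid, h⟩ := replicate_append_cons_inj (mark_ne_zero two_pos) (by omega) h
  rw [← List.append_assoc, List.replicate_append_replicate] at h
  obtain ⟨hkk', hright, -⟩ := replicate_append_cons_inj (mark_ne_zero three_pos) (by omega) h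
  obtain ⟨hA, hleft⟩ := ne_zero_and_eq_of_mark_eq one_pos (by decide) hleft
  obtain ⟨hB, hmid⟩ := ne_zero_and_eq_of_mark_eq two_pos (by decide) hmid
  obtain ⟨hC, hright⟩ := ne_zero_and_eq_of_mark_eq three_pos (by decide) hright
  obtain ⟨hi, hjc⟩ := mul_add_inj hj hc hleft
  obtain ⟨hj'c, hkd⟩ := mul_add_inj hk hd hmid
  obtain ⟨hi', hk'd⟩ := mul_add_inj hk' hd hright
  have hj' := Nat.mod_lt j' hb
  have hk' := Nat.mod_lt k' hb
  obtain rfl : i = i' := hi.trans hi'.symm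
  obtain rfl : j = j' := Nat.ext_div_mod (hjc.trans hj'c.symm) (by omega)
  obtain rfl : k = k' := Nat.ext_div_mod (hkd.trans hk'd.symm) (by omega)
  exact ⟨rfl, rfl, rfl, hA, hB, hC⟩

end

/-! ### The text has an occurrence of the pattern if and only if there is a triangle -/

section

variable {r b m D : ℕ} {A B C : ℕ → ℕ → ℕ}

theorem HasTriangle.of_spells_core (hb : 0 < b) (hm : m = r * b) {ws : List ℕ}
    (h : Spells (core r b m D A B C) (ws.flatMap (piece r b))) : HasTriangle m A B C := by
  have hdiv : ∀ j < m, j / b < r := fun j hj => (Nat.div_lt_iff_lt_mul hb).2 (hm ▸ hj)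
  simp only [core, spells_append, matrixSegments, Spells, mem_grid] at h
  obtain ⟨p, _, h, hp, _, s, rfl, ⟨_, ⟨i, hi, j, hj, rfl⟩, _, rfl, _, ⟨j', hj', k, hk, rfl⟩, _,
    rfl, _, ⟨k', hk', i', hi', rfl⟩, _, rfl, rfl⟩, _⟩ := h
  obtain ⟨zs, rfl⟩ := hp.exists_flatMap_piece fun R hR u hu => by
    obtain ⟨t, rfl⟩ := exists_eq_skipSegment_of_mem hR
    exact exists_flatMap_piece_of_mem_skipSegment hu
  obtain ⟨vs, hvs⟩ := exists_flatMap_piece_of_append h.symm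
  cases vs with
  | nil => simp [leftString] at hvs
  | cons z vs =>
    simp only [List.append_nil, List.append_assoc, List.flatMap_cons] at hvs
    obtain ⟨rfl, rfl, rfl, hA, hB, hC⟩ :=
      triangle_of_append_eq_piece_append hb (hdiv j hj) (hdiv k hk) (hdiv k' hk') hvs
    exact ⟨i, hi, j, hj, k, hk, hA, hB, hC⟩

theorem HasTriangle.spells_core (hb : 0 < b) (hm : m = r * b) (hD : m * r * r = r ^ D)
    (h : HasTriangle m A B C) : Spells (core r b m D A B C) (pieces r b 0 (r ^ D)) := by
  obtain ⟨i, hi, j, hj, k, hk, hA, hB, hC⟩ := h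
  have hj' : j / b < r := (Nat.div_lt_iff_lt_mul hb).2 (hm ▸ hj)
  have hk' : k / b < r := (Nat.div_lt_iff_lt_mul hb).2 (hm ▸ hk)
  have hr : 0 < r := Nat.zero_lt_of_lt hj'
  obtain ⟨z, hz⟩ : ∃ z, z = (i * r + j / b) * r + k / b := ⟨_, rfl⟩
  have hlt : z < r ^ D := by
    have hrow : i * r + j / b + 1 ≤ m * r := by nlinarith
    rw [← hD]
    nlinarith
  have hpieces : pieces r b 0 (r ^ D) =
      pieces r b 0 z ++ (piece r b z ++ pieces r b (z + 1) (r ^ D - z - 1)) := by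
    rw [← pieces_one, ← pieces_add]
    nth_rewrite 2 [← Nat.zero_add z]
    rw [← pieces_add]
    congr 1
    omega
  simp only [core, spells_append, matrixSegments, Spells, mem_grid]
  refine ⟨_, _, hpieces, ?_, _, _, rfl, ⟨_, ⟨i, hi, j, hj, rfl⟩, _, ?_, _, ⟨j, hj, k, hk, rfl⟩, _,
    rfl, _, ⟨k, hk, i, hi, rfl⟩, [], rfl, rfl⟩, ?_⟩
  · simpa only [Nat.zero_mul] using
      spells_skipSegments (b := b) le_rfl hr (e := 0) hlt (Nat.one_mul _).le
  · rw [List.append_nil, hz, append_eq_piece hb hj' hk' hA hB hC]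
  · exact spells_reverse_skipSegments le_rfl hr (e := 0) (by omega) (by omega) (Nat.one_mul _).le

variable {x : ℕ} (hx : x = 4 ∨ x = 8)
include hx

theorem not_mem_of_mem_skipSegment {t : ℕ} {u : List ℕ} (hu : u ∈ skipSegment r b D t) :
    x ∉ u := by
  obtain ⟨zs, rfl⟩ := exists_flatMap_piece_of_mem_skipSegment hu
  simp only [List.mem_flatMap, not_exists, not_and, piece, List.mem_cons, List.mem_append,
    List.mem_replicate, List.not_mem_nil, or_false]
  omega

theorem ne_mark {a v tag : ℕ} (h : 0 < tag) (h' : tag < 4) : x ≠ mark a v tag := by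
  unfold mark; split <;> omega

theorem not_mem_of_mem_matrixSegments {R : List (List ℕ)} (hR : R ∈ matrixSegments r b m A B C)
    {u : List ℕ} (hu : u ∈ R) : x ∉ u := by
  have hx0 : x ≠ 0 := by omega
  simp only [matrixSegments, List.mem_cons, List.not_mem_nil, or_false] at hR
  rcases hR with rfl | rfl | rfl <;> obtain ⟨i, -, j, -, rfl⟩ := mem_grid.1 hu
  · simp [leftString, hx0, ne_mark hx one_pos]
  · simp [midString, hx0, ne_mark hx two_pos]
  · simp [rightString, hx0, ne_mark hx three_pos]

theorem not_mem_of_mem_core : ∀ R ∈ core r b m D A B C, ∀ u ∈ R, x ∉ u := by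
  intro R hR u hu
  simp only [core, List.mem_append, List.mem_reverse] at hR
  obtain hskip | hmatrix : R ∈ skipSegments r b D D ∨ R ∈ matrixSegments r b m A B C := by tauto
  · obtain ⟨t, rfl⟩ := exists_eq_skipSegment_of_mem hskip
    exact not_mem_of_mem_skipSegment hx hu
  · exact not_mem_of_mem_matrixSegments hx hmatrix hu

end

section

variable {r b m D : ℕ}

theorem exists_occEndsAt_text_iff (hb : 0 < b) (hm : m = r * b) (hD : m * r * r = r ^ D)
    (A B C : ℕ → ℕ → ℕ) :
    (∃ j < (text r b m D A B C).length,
      OccEndsAt (pattern r b (r ^ D)) (text r b m D A B C) j) ↔ HasTriangle m A B C := by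
  rw [text, pattern, exists_occEndsAt_delimited_iff (by decide) (not_mem_of_mem_core (.inl rfl))
    (not_mem_of_mem_core (.inr rfl))]
  exact ⟨.of_spells_core hb hm, HasTriangle.spells_core hb hm hD⟩

variable (A B C : ℕ → ℕ → ℕ)

theorem length_text : (text r b m D A B C).length = 2 * D * r + 5 := by
  simp only [text, core, matrixSegments, List.length_cons, List.length_append, List.length_nil,
    List.length_reverse, length_skipSegments]
  ring

theorem length_pattern_le_textSize_text (hr : r ≠ 0) (hD : D ≠ 0) :
    (pattern r b (r ^ D)).length ≤ textSize (text r b m D A B C) := by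
  have hmem : skipSegment r b D 0 ∈ core r b m D A B C :=
    List.mem_append_left _ (skipSegment_zero_mem_skipSegments hr hD)
  have hle : [skipSegment r b D 0].flatten.flatten.length ≤ textSize (core r b m D A B C) :=
    (List.singleton_sublist.2 hmem).flatten.flatten.length_le
  rw [List.flatten_singleton, length_flatten_skipSegment, Nat.sub_zero, pow_zero, one_mul] at hle
  have htext : textSize (text r b m D A B C) = textSize (core r b m D A B C) + 2 := by
    simp [textSize, text]
  rw [length_pattern, htext]
  omega

theorem isInstance_text (hr : r ≠ 0) (hb : 0 < b) (hm : m = r * b) (hD : D ≠ 0) :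
    IsInstance (pattern r b (r ^ D)) (text r b m D A B C) := by
  refine ⟨List.cons_ne_nil _ _, fun S hS => ?_, length_pattern_le_textSize_text A B C hr hD⟩
  have hdiv : ∀ j < m, j / b < r := fun j hj => (Nat.div_lt_iff_lt_mul hb).2 (hm ▸ hj)
  have hpos : 0 < m := hm ▸ Nat.mul_pos (Nat.pos_of_ne_zero hr) hb
  have hgrid : ∀ g : ℕ → ℕ → List ℕ, grid m g ≠ [] := fun g =>
    List.ne_nil_of_mem (mem_grid.2 ⟨0, hpos, 0, hpos, rfl⟩)
  have hskip : S ∈ skipSegments r b D D → S ≠ [] ∧ S.Nodup := fun h => by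
    obtain ⟨t, rfl⟩ := exists_eq_skipSegment_of_mem h
    exact ⟨List.cons_ne_nil _ _, nodup_skipSegment (Nat.pos_of_ne_zero hr)⟩
  simp only [text, core, List.mem_cons, List.mem_append, List.mem_reverse, matrixSegments,
    List.not_mem_nil, or_false] at hS
  rcases hS with rfl | (hS | (rfl | rfl | rfl) | hS) | rfl
  · simp
  · exact hskip hS
  · exact ⟨hgrid _, nodup_grid fun i _ j hj i' _ j' hj' => leftString_inj (hdiv j hj) (hdiv j' hj')⟩
  · exact ⟨hgrid _, nodup_grid fun j _ k hk j' _ k' hk' =>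
      midString_inj hb (hdiv k hk) (hdiv k' hk')⟩
  · exact ⟨hgrid _, nodup_grid fun k hk i _ k' hk' i' _ =>
      rightString_inj hb (hdiv k hk) (hdiv k' hk')⟩
  · exact hskip hS
  · simp

end

/-! ### The template of the instance -/

/-- A letter that does not depend on the input. -/
def Slot.fixed (v : ℕ) : Slot := ⟨0, v, v⟩

/-- The template of an input that does not depend on the other one. -/
def Template.fixed (x : Data) : Template := x.map fun g => g.map fun s => s.map Slot.fixed

/-- The position in the input of entry `i`, `j` of the matrix number `base`, out of three matrices
of order `n`; a position beyond the end if there is no such entry. -/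
def entryPos (n base i j : ℕ) : ℕ :=
  base * (n * n) + (i * n + j) + 3 * (n * n) * ((if n ≤ i then 1 else 0) + if n ≤ j then 1 else 0)

/-- The letter `mark a v tag`, where `a` is the letter of the input at position `p`. -/
def markSlot (p v tag : ℕ) : Slot := ⟨p, 4 * v + tag, 4 * v + 12⟩

/-- The template of the segments of the matrices, for matrices of order `n` padded to order `m`. -/
def matrixTemplate (n r b m : ℕ) : Template :=
  [grid m fun i j => markSlot (entryPos n 0 i j) (i * r + j / b) 1 ::
      List.replicate (j % b) (Slot.fixed 0),
    grid m fun j k => List.replicate (b - j % b) (Slot.fixed 0) ++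
      markSlot (entryPos n 1 j k) (j / b * r + k / b) 2 :: List.replicate (k % b) (Slot.fixed 0),
    grid m fun k i => List.replicate (b - k % b) (Slot.fixed 0) ++
      [markSlot (entryPos n 2 k i) (i * r + k / b) 3]]

/-- The template of the pattern and the text for given parameters. -/
def blockTemplate (D n r b m : ℕ) : Template :=
  .fixed ([pattern r b (r ^ D)] :: [[4]] :: skipSegments r b D D) ++
    (matrixTemplate n r b m ++ .fixed ((skipSegments r b D D).reverse ++ [[[8]]]))

/-- `x + 1` is the `q`-th root of `n`, rounded up. -/
abbrev IsCeilRoot (q n x : ℕ) : Prop := x ^ q < n ∧ n ≤ (x + 1) ^ q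

/-- The template of the instance for matrices of order `n`, where `r` is the `q`-th root of `n`,
rounded up; the matrices are padded to order `r ^ q`. -/
def template (q n : ℕ) : Template :=
  (List.range n).flatMap fun x =>
    if IsCeilRoot q n x then
      blockTemplate (q + 2) n (x + 1) ((x + 1) ^ (q - 1)) ((x + 1) ^ q)
    else []

section

variable (L : ℕ → ℕ)

theorem Slot.inst_fixed (v : ℕ) : (Slot.fixed v).inst L = v := ite_self v

theorem Slot.inst_markSlot (p v tag : ℕ) : (markSlot p v tag).inst L = mark (L p) v tag := rfl

theorem Template.inst_fixed (x : Data) : (Template.fixed x).inst L = x := by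
  simp [Template.fixed, Template.inst, Function.comp_def, Slot.inst_fixed]

theorem inst_matrixTemplate (n r b m : ℕ) :
    (matrixTemplate n r b m).inst L = matrixSegments r b m (fun i j => L (entryPos n 0 i j))
      (fun j k => L (entryPos n 1 j k)) fun k i => L (entryPos n 2 k i) := by
  simp only [matrixTemplate, Template.inst, List.map_cons, List.map_nil, map_grid, List.map_append,
    List.map_replicate, Slot.inst_fixed, Slot.inst_markSlot]
  rfl

theorem inst_blockTemplate (D n r b m : ℕ) :
    (blockTemplate D n r b m).inst L = [pattern r b (r ^ D)] ::
      text r b m D (fun i j => L (entryPos n 0 i j)) (fun j k => L (entryPos n 1 j k))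
        fun k i => L (entryPos n 2 k i) := by
  simp only [blockTemplate, Template.inst_append, Template.inst_fixed, inst_matrixTemplate, text,
    core, List.cons_append, List.append_assoc]

end

/-! ### The generator of the instance -/

instance : Add Arith := ⟨.bin .add⟩
instance : Sub Arith := ⟨.bin .sub⟩
instance : Mul Arith := ⟨.bin .mul⟩
instance : Div Arith := ⟨.bin .div⟩
instance : Mod Arith := ⟨.bin .mod⟩
instance (n : ℕ) : OfNat Arith n := ⟨.const n⟩

namespace Arith

section

variable (env : List ℕ) (a b : Arith)

@[simp] theorem eval_add : (a + b).eval env = a.eval env + b.eval env := rfl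
@[simp] theorem eval_sub : (a - b).eval env = a.eval env - b.eval env := rfl
@[simp] theorem eval_mul : (a * b).eval env = a.eval env * b.eval env := rfl
@[simp] theorem eval_mod : (a % b).eval env = a.eval env % b.eval env := rfl
@[simp] theorem eval_lt :
    (bin .lt a b).eval env = if a.eval env < b.eval env then 1 else 0 := rfl
@[simp] theorem eval_ofNat (n : ℕ) :
    (no_index (OfNat.ofNat n) : Arith).eval env = OfNat.ofNat n := rfl
@[simp] theorem eval_const (n : ℕ) : (const n).eval env = n := rfl
@[simp] theorem eval_var (v : ℕ) : (var v).eval env = env.getD v 0 := rfl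

end

/-- Powers with a fixed exponent. -/
def power (e : Arith) : ℕ → Arith
  | 0 => 1
  | k + 1 => e.power k * e

@[simp] theorem eval_power (env : List ℕ) (e : Arith) (k : ℕ) :
    (e.power k).eval env = e.eval env ^ k := by
  induction k with
  | zero => rfl
  | succ k ih => rw [power, eval_mul, ih, pow_succ]

end Arith

open Arith

/-- The order of the matrices. -/
abbrev orderVar : Arith := .var 0

/-- The loop variable that is 1 less than `rootVar`. -/
abbrev rootPredVar : Arith := .var 1

/-- The root `r` of the order of the padded matrices. -/
abbrev rootVar : Arith := .var 2

/-- The number of columns in a block. -/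
abbrev blockVar : Arith := .var 3

/-- The order of the padded matrices. -/
abbrev paddedVar : Arith := .var 4

/-- The variable of the outermost loop that uses the parameters. -/
abbrev loopVar₁ : Arith := .var 5

/-- The variable of the second loop that uses the parameters. -/
abbrev loopVar₂ : Arith := .var 6

/-- The variable of the third loop that uses the parameters. -/
abbrev loopVar₃ : Arith := .var 7

/-- A letter that does not depend on the input. -/
def emitFixed (e : Arith) : Gen := .emit 0 e e

/-- A run of zeros. -/
def zeros (e : Arith) : Gen := .loop e (emitFixed 0)

/-- A piece of the pattern. -/
def pieceGen (z : Arith) : Gen :=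
  .seq (emitFixed (4 * (z / rootVar) + 1)) <| .seq (zeros blockVar) <|
  .seq (emitFixed (4 * (z % (rootVar * rootVar)) + 2)) <| .seq (zeros blockVar) <|
  emitFixed (4 * (z / (rootVar * rootVar) * rootVar + z % rootVar) + 3)

/-- The end of a string that is the last one of its group. -/
def endBoth : Gen := .seq .endString .endGroup

/-- The pattern, in a group of its own. -/
def patternGen (D : ℕ) : Gen :=
  .seq (emitFixed 4) <| .seq (.loop (rootVar.power D) (pieceGen loopVar₁)) <|
  .seq (emitFixed 8) endBoth

/-- The copies of a segment for skipping. -/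
def skipGen (D t : ℕ) : Gen :=
  .loop rootVar <| .seq .endString <| .seq
    (.loop (rootVar.power (D - t)) <| .seq
      (.loop (rootVar.power t) (pieceGen (loopVar₂ * rootVar.power t + loopVar₃)))
      .endString)
    .endGroup

/-- The segments by which an initial part of the pattern is skipped. -/
def skipsGen (D : ℕ) : ℕ → Gen
  | 0 => .skip
  | t + 1 => .seq (skipGen D t) (skipsGen D t)

/-- The segments by which a final part of the pattern is skipped. -/
def reverseSkipsGen (D : ℕ) : ℕ → Gen
  | 0 => .skip
  | t + 1 => .seq (reverseSkipsGen D t) (skipGen D t)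

/-- A segment with a string for every entry of a padded matrix, where `loopVar₁` is the row and
`loopVar₂` the column. -/
def gridGen (G : Gen) : Gen :=
  .seq (.loop paddedVar (.loop paddedVar (.seq G .endString))) .endGroup

/-- The position of entry `loopVar₁`, `loopVar₂` of the matrix number `base`. -/
def entryPosArith (base : ℕ) : Arith :=
  .const base * (orderVar * orderVar) + (loopVar₁ * orderVar + loopVar₂) +
    3 * (orderVar * orderVar) *
      (.bin .lt orderVar (loopVar₁ + 1) + .bin .lt orderVar (loopVar₂ + 1))

/-- A separator that depends on an entry of the matrix number `base`. -/
def markGen (base : ℕ) (v : Arith) (tag : ℕ) : Gen :=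
  .emit (entryPosArith base) (4 * v + .const tag) (4 * v + 12)

/-- The string of an entry of the first matrix. -/
def leftGen : Gen :=
  .seq (markGen 0 (loopVar₁ * rootVar + loopVar₂ / blockVar) 1) <|
  zeros (loopVar₂ % blockVar)

/-- The string of an entry of the second matrix. -/
def midGen : Gen :=
  .seq (zeros (blockVar - loopVar₁ % blockVar)) <|
  .seq (markGen 1 (loopVar₁ / blockVar * rootVar + loopVar₂ / blockVar) 2) <|
  zeros (loopVar₂ % blockVar)

/-- The string of an entry of the third matrix. -/
def rightGen : Gen :=
  .seq (zeros (blockVar - loopVar₁ % blockVar)) <|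
  markGen 2 (loopVar₂ * rootVar + loopVar₁ / blockVar) 3

/-- The segments of the three matrices. -/
def matrixGen : Gen := .seq (gridGen leftGen) <| .seq (gridGen midGen) <| gridGen rightGen

/-- The instance for given parameters. -/
def blockGen (D : ℕ) : Gen :=
  .seq (patternGen D) <| .seq (.seq (emitFixed 4) endBoth) <| .seq (skipsGen D D) <|
  .seq matrixGen <| .seq (reverseSkipsGen D D) <| .seq (emitFixed 8) endBoth

/-- The instance if `rootPredVar + 1` is the rounded root of the order, and nothing otherwise. -/
def guardedGen (q : ℕ) : Gen :=
  .guard (.bin .lt (rootPredVar.power q) orderVar) <|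
  .guard (.bin .lt orderVar ((rootPredVar + 1).power q + 1)) <|
  .letIn (rootPredVar + 1) <| .letIn (rootVar.power (q - 1)) <| .letIn (rootVar.power q) <|
  blockGen (q + 2)

/-- The generator of the instance, which tries all numbers as the root. -/
def instanceGen (q : ℕ) : Gen := .loop orderVar (guardedGen q)

/-! ### Correctness of the generator -/

theorem letterTokens_append (s s' : List Slot) :
    letterTokens (s ++ s') = letterTokens s ++ letterTokens s' := List.map_append

theorem templateTokens_fixed_append (x y : Data) :
    templateTokens (.fixed (x ++ y)) =
      templateTokens (.fixed x) ++ templateTokens (.fixed y) := by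
  rw [← templateTokens_append, Template.fixed, List.map_append]; rfl

theorem flatMap_range_const {α : Type*} (n : ℕ) (l : List α) :
    ((List.range n).flatMap fun _ => l) = (List.replicate n l).flatten := by
  rw [List.flatMap_def, List.map_const', List.length_range]

/-- The items of the letters of a string that does not depend on the input. -/
def fixedTokens (s : List ℕ) : List Token := letterTokens (s.map Slot.fixed)

theorem fixedTokens_append (s s' : List ℕ) :
    fixedTokens (s ++ s') = fixedTokens s ++ fixedTokens s' := by
  rw [fixedTokens, List.map_append, letterTokens_append]; rfl

theorem fixedTokens_flatMap (l : List ℕ) (f : ℕ → List ℕ) :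
    fixedTokens (l.flatMap f) = l.flatMap fun i => fixedTokens (f i) := by
  simp only [fixedTokens, letterTokens, List.map_flatMap]

theorem groupTokens_map_fixed (g : List (List ℕ)) :
    groupTokens (g.map fun s => s.map Slot.fixed) =
      (g.flatMap fun s => fixedTokens s ++ [.endString]) ++ [.endGroup] := by
  simp only [groupTokens, List.flatMap_map, stringTokens, fixedTokens]

theorem tokens_emitFixed (e : Arith) (env : List ℕ) :
    (emitFixed e).tokens env = fixedTokens [e.eval env] := rfl

theorem tokens_zeros (e : Arith) (env : List ℕ) :
    (zeros e).tokens env = letterTokens (List.replicate (e.eval env) (Slot.fixed 0)) := by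
  simp only [zeros, Gen.tokens, tokens_emitFixed, eval_ofNat, flatMap_range_const]
  simp [letterTokens, fixedTokens]

theorem tokens_pieceGen (z : Arith) (env : List ℕ) :
    (pieceGen z).tokens env =
      fixedTokens (piece (rootVar.eval env) (blockVar.eval env) (z.eval env)) := by
  have hzeros : ∀ k, letterTokens (List.replicate k (Slot.fixed 0)) =
      fixedTokens (List.replicate k 0) := fun k => by rw [fixedTokens, List.map_replicate]
  simp only [pieceGen, Gen.tokens, tokens_emitFixed, tokens_zeros, hzeros, ← fixedTokens_append,
    piece, List.singleton_append]
  rfl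

section

variable (D n x r b m : ℕ)

theorem tokens_patternGen :
    (patternGen D).tokens [n, x, r, b, m] = templateTokens (.fixed [[pattern r b (r ^ D)]]) := by
  have hpieces : (Gen.loop (rootVar.power D) (pieceGen loopVar₁)).tokens [n, x, r, b, m] =
      fixedTokens (pieces r b 0 (r ^ D)) := by
    rw [pieces, fixedTokens_flatMap, ← List.range_eq_range', Gen.tokens, eval_power]
    exact congrArg (fun f => List.flatMap f _) (funext fun z => tokens_pieceGen ..)
  have hpattern : pattern r b (r ^ D) = [4] ++ (pieces r b 0 (r ^ D) ++ [8]) := rfl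
  rw [Template.fixed, List.map_singleton, templateTokens, List.flatMap_singleton,
    groupTokens_map_fixed, List.flatMap_singleton, hpattern, fixedTokens_append,
    fixedTokens_append, ← hpieces]
  simp only [patternGen, Gen.tokens, List.append_assoc]
  rfl

theorem tokens_skipGen (t : ℕ) :
    (skipGen D t).tokens [n, x, r, b, m] =
      templateTokens (.fixed (List.replicate r (skipSegment r b D t))) := by
  have hpieces : ∀ i c, ((List.range (r ^ t)).flatMap fun u =>
      (pieceGen (loopVar₂ * rootVar.power t + loopVar₃)).tokens [n, x, r, b, m, i, c, u]) =
        fixedTokens (pieces r b (c * r ^ t) (r ^ t)) := fun i c => by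
    rw [pieces, fixedTokens_flatMap, List.range'_eq_map_range, List.flatMap_map]
    simp [tokens_pieceGen]
  have hgroup : groupTokens ((skipSegment r b D t).map fun s => s.map Slot.fixed) =
      .endString :: ((List.range (r ^ (D - t))).flatMap fun c =>
        fixedTokens (pieces r b (c * r ^ t) (r ^ t)) ++ [.endString]) ++ [.endGroup] := by
    rw [groupTokens_map_fixed, skipSegment, List.flatMap_cons, List.flatMap_map]
    rfl
  rw [Template.fixed, List.map_replicate, templateTokens, List.flatMap_replicate, hgroup,
    ← flatMap_range_const, skipGen]
  simp only [Gen.tokens, List.cons_append, List.nil_append, hpieces, eval_power, eval_var,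
    List.getD_cons_succ, List.getD_cons_zero]

theorem tokens_skipsGen (t : ℕ) :
    (skipsGen D t).tokens [n, x, r, b, m] = templateTokens (.fixed (skipSegments r b D t)) := by
  induction t with
  | zero => rfl
  | succ t ih =>
    rw [skipsGen, Gen.tokens, ih, tokens_skipGen, skipSegments, templateTokens_fixed_append]

theorem tokens_reverseSkipsGen (t : ℕ) :
    (reverseSkipsGen D t).tokens [n, x, r, b, m] =
      templateTokens (.fixed (skipSegments r b D t).reverse) := by
  induction t with
  | zero => rfl
  | succ t ih =>
    rw [reverseSkipsGen, Gen.tokens, ih, tokens_skipGen, reverse_skipSegments_succ,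
      templateTokens_fixed_append]

theorem tokens_gridGen {G : Gen} {g : ℕ → ℕ → List Slot}
    (h : ∀ i j, G.tokens [n, x, r, b, m, i, j] = letterTokens (g i j)) :
    (gridGen G).tokens [n, x, r, b, m] = groupTokens (grid m g) := by
  simp only [gridGen, Gen.tokens, eval_var, List.cons_append, List.nil_append, h,
    List.getD_cons_succ, List.getD_cons_zero, groupTokens, grid,
    List.flatMap_map, stringTokens, SProd.sprod, List.product, List.flatMap_assoc]

theorem tokens_markGen (base : ℕ) (v : Arith) (tag i j : ℕ) :
    (markGen base v tag).tokens [n, x, r, b, m, i, j] =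
      letterTokens [markSlot (entryPos n base i j) (v.eval [n, x, r, b, m, i, j]) tag] := by
  have hpos : (entryPosArith base).eval [n, x, r, b, m, i, j] = entryPos n base i j := by
    simp [entryPosArith, entryPos, Nat.lt_succ_iff]
  rw [markGen, Gen.tokens, hpos]
  rfl

theorem tokens_matrixGen :
    matrixGen.tokens [n, x, r, b, m] = templateTokens (matrixTemplate n r b m) := by
  simp only [matrixGen, Gen.tokens, matrixTemplate, templateTokens, List.flatMap_cons,
    List.flatMap_nil, List.append_nil]
  congr 1
  · refine tokens_gridGen n x r b m fun i j => ?_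
    simp only [leftGen, Gen.tokens, tokens_markGen, tokens_zeros, ← letterTokens_append]
    rfl
  congr 1
  · refine tokens_gridGen n x r b m fun j k => ?_
    simp only [midGen, Gen.tokens, tokens_markGen, tokens_zeros, ← letterTokens_append]
    rfl
  · refine tokens_gridGen n x r b m fun k i => ?_
    simp only [rightGen, Gen.tokens, tokens_markGen, tokens_zeros, ← letterTokens_append]
    rfl

theorem tokens_blockGen :
    (blockGen D).tokens [n, x, r, b, m] = templateTokens (blockTemplate D n r b m) := by
  have hsegments : [pattern r b (r ^ D)] :: [[4]] :: skipSegments r b D D =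
      [[pattern r b (r ^ D)]] ++ ([[[4]]] ++ skipSegments r b D D) := rfl
  simp only [blockTemplate, hsegments, templateTokens_append, templateTokens_fixed_append,
    blockGen, Gen.tokens, tokens_patternGen, tokens_skipsGen, tokens_matrixGen,
    tokens_reverseSkipsGen, List.append_assoc]
  rfl

end

theorem describes_instanceGen (q : ℕ) : (instanceGen q).Describes (template q) := by
  intro n
  rw [instanceGen, Gen.tokens, template, templateTokens, List.flatMap_assoc]
  refine congrArg (fun f => List.flatMap f _) (funext fun x => ?_)
  simp only [guardedGen, Gen.tokens, List.cons_append, List.nil_append, eval_lt, eval_power,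
    eval_var, eval_add, eval_ofNat, List.getD_cons_succ, List.getD_cons_zero, Nat.lt_succ_iff,
    ite_eq_right_iff, one_ne_zero, imp_false]
  by_cases hx : IsCeilRoot q n x
  · rw [if_pos hx, if_neg (not_not.2 hx.1), if_neg (not_not.2 hx.2)]
    exact tokens_blockGen ..
  · rw [if_neg hx]
    grind

/-! ### The entries of the matrices in the input -/

theorem getD_flatten {α : Type*} {n : ℕ} {l : List (List α)} (hl : ∀ s ∈ l, s.length = n)
    (i : ℕ) {j : ℕ} (hj : j < n) (d : α) :
    l.flatten.getD (i * n + j) d = (l.getD i []).getD j d := by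
  induction l generalizing i with
  | nil => rfl
  | cons s l ih =>
    obtain ⟨hs, hl⟩ := List.forall_mem_cons.1 hl
    cases i with
    | zero =>
      rw [List.flatten_cons, List.getD_append _ _ _ _ (by omega), Nat.zero_mul, Nat.zero_add,
        List.getD_cons_zero]
    | succ i =>
      have hpos : (i + 1) * n + j = n + (i * n + j) := by ring
      rw [List.flatten_cons, hpos, List.getD_append_right _ _ _ _ (by omega), hs,
        Nat.add_sub_cancel_left, ih hl, List.getD_cons_succ]

section

variable {n : ℕ} (A B C : Matrix (Fin n) (Fin n) Bool)

theorem length_rows : (rows A).length = n := List.length_ofFn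

theorem length_of_mem_rows : ∀ s ∈ rows A, s.length = n := by
  simp [rows]

theorem length_flatten_rows : (rows A).flatten.length = n * n := by
  simp [rows, List.length_flatten, List.map_ofFn, Function.comp_def]

theorem order_rows : order [rows A, rows B, rows C] = n := by
  simp [order, length_rows]

theorem letters_rows :
    letters [rows A, rows B, rows C] =
      [(rows A).flatten, (rows B).flatten, (rows C).flatten].flatten := by
  simp [letters]

theorem getD_flatten_rows (i j : Fin n) :
    (rows A).flatten.getD (i * n + j) 0 = (A i j).toNat := by
  rw [getD_flatten (length_of_mem_rows A) _ j.2]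
  simp [rows, List.getD_eq_getElem?_getD]

theorem getD_letters_rows (base : Fin 3) (i j : Fin n) :
    (letters [rows A, rows B, rows C]).getD (entryPos n base i j) 0 =
      (![A, B, C] base i j).toNat := by
  have hpos : entryPos n base i j = base * (n * n) + (i * n + j) := by
    simp [entryPos]
  have hlt : (i * n + j : ℕ) < n * n := by nlinarith [i.2, j.2]
  have hlen : ∀ s ∈ [(rows A).flatten, (rows B).flatten, (rows C).flatten], s.length = n * n := by
    simp [length_flatten_rows, -List.length_flatten]
  rw [hpos, letters_rows, getD_flatten hlen _ hlt]
  fin_cases base <;> exact getD_flatten_rows ..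

theorem getD_letters_rows_eq_zero {i j : ℕ} (h : n ≤ i ∨ n ≤ j) (base : ℕ) :
    (letters [rows A, rows B, rows C]).getD (entryPos n base i j) 0 = 0 := by
  refine List.getD_eq_default _ _ ?_
  have hbeyond : 1 ≤ (if n ≤ i then 1 else 0) + if n ≤ j then 1 else 0 := by grind
  calc (letters [rows A, rows B, rows C]).length = 3 * (n * n) := by
        simp only [letters_rows, List.flatten_cons, List.flatten_nil, List.length_append,
          length_flatten_rows, List.length_nil]
        ring
    _ ≤ _ := (Nat.le_mul_of_pos_right _ hbeyond).trans (Nat.le_add_left ..)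

theorem getD_letters_rows_ne_zero (base : Fin 3) (i j : ℕ) :
    (letters [rows A, rows B, rows C]).getD (entryPos n base i j) 0 ≠ 0 ↔
      ∃ i' j' : Fin n, ↑i' = i ∧ ↑j' = j ∧ ![A, B, C] base i' j' = true := by
  by_cases hij : i < n ∧ j < n
  · lift i to Fin n using hij.1
    lift j to Fin n using hij.2
    rw [getD_letters_rows]
    simp [Fin.val_inj]
  · rw [getD_letters_rows_eq_zero A B C (by omega)]
    simp only [ne_eq, not_true_eq_false, false_iff]
    rintro ⟨i', j', rfl, rfl, -⟩
    exact hij ⟨i'.2, j'.2⟩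

/-- Padding does not create triangles, since the added entries are zero. -/
theorem hasTriangle_letters_rows_iff {m : ℕ} (hm : n ≤ m) :
    HasTriangle m (fun i j => (letters [rows A, rows B, rows C]).getD (entryPos n 0 i j) 0)
        (fun j k => (letters [rows A, rows B, rows C]).getD (entryPos n 1 j k) 0)
        (fun k i => (letters [rows A, rows B, rows C]).getD (entryPos n 2 k i) 0) ↔
      ∃ i j k, A i j = true ∧ B j k = true ∧ C k i = true := by
  have hA := getD_letters_rows_ne_zero A B C 0
  have hB := getD_letters_rows_ne_zero A B C 1
  have hC := getD_letters_rows_ne_zero A B C 2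
  simp only [Fin.val_zero, Fin.val_one, Fin.val_two, Matrix.cons_val_zero, Matrix.cons_val_one,
    Matrix.cons_val] at hA hB hC
  simp only [HasTriangle, hA, hB, hC]
  constructor
  · rintro ⟨_, -, _, -, _, -, ⟨i, j, rfl, rfl, hA⟩, ⟨j', k, hj, rfl, hB⟩, ⟨k', i', hk, hi, hC⟩⟩
    obtain rfl := Fin.ext hj
    obtain rfl := Fin.ext hk
    obtain rfl := Fin.ext hi
    exact ⟨i', j', k', hA, hB, hC⟩
  · rintro ⟨i, j, k, hA, hB, hC⟩
    exact ⟨i, by omega, j, by omega, k, by omega, ⟨i, j, rfl, rfl, hA⟩, ⟨j, k, rfl, rfl, hB⟩,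
      ⟨k, i, rfl, rfl, hC⟩⟩

end

/-! ### The root of the order -/

section

variable {q n x : ℕ}

theorem exists_isCeilRoot (hq : q ≠ 0) (hn : n ≠ 0) : ∃ x, IsCeilRoot q n x := by
  have hex : ∃ k, n ≤ k ^ q := ⟨n, Nat.le_self_pow hq n⟩
  obtain ⟨x, hx⟩ : ∃ x, Nat.find hex = x + 1 := Nat.exists_eq_succ_of_ne_zero fun h0 => by
    have hspec := Nat.find_spec hex
    rw [h0, zero_pow hq] at hspec
    omega
  exact ⟨x, not_le.1 (Nat.find_min hex (by omega)), hx ▸ Nat.find_spec hex⟩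

theorem IsCeilRoot.lt (hq : q ≠ 0) (hx : IsCeilRoot q n x) : x < n :=
  (Nat.le_self_pow hq x).trans_lt hx.1

theorem IsCeilRoot.unique {y : ℕ} (hx : IsCeilRoot q n x) (hy : IsCeilRoot q n y) : x = y := by
  have hle : ∀ {x y}, IsCeilRoot q n x → IsCeilRoot q n y → x ≤ y := fun hx hy =>
    Nat.lt_succ_iff.1 (lt_of_pow_lt_pow_left' q (hx.1.trans_le hy.2))
  exact le_antisymm (hle hx hy) (hle hy hx)

end

theorem flatMap_range_ite {α : Type*} {p : ℕ → Prop} [DecidablePred p] {x : ℕ} (hx : p x)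
    (huniq : ∀ y, p y → y = x) (g : ℕ → List α) (n : ℕ) :
    ((List.range n).flatMap fun y => if p y then g y else []) = if x < n then g x else [] := by
  induction n with
  | zero => rfl
  | succ n ih =>
    rw [List.range_succ, List.flatMap_append, ih, List.flatMap_singleton]
    grind

theorem template_eq_blockTemplate {q n x : ℕ} (hq : q ≠ 0) (hx : IsCeilRoot q n x) :
    template q n = blockTemplate (q + 2) n (x + 1) ((x + 1) ^ (q - 1)) ((x + 1) ^ q) := by
  rw [template, flatMap_range_ite hx (fun _ hy => hy.unique hx), if_pos (hx.lt hq)]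

/-! ### The work of the generator -/

theorem Gen.work_loop_le {e : Arith} {G : Gen} {env : List ℕ} {W : ℕ}
    (h : ∀ i < e.eval env, G.work (env ++ [i]) ≤ W) :
    (Gen.loop e G).work env ≤ 1 + e.eval env * (1 + W) := by
  have hsum := List.sum_le_card_nsmul ((List.range (e.eval env)).map fun i =>
    1 + G.work (env ++ [i])) (1 + W) (by simpa using h)
  rw [Gen.work]
  simpa using hsum

theorem work_zeros (e : Arith) (env : List ℕ) : (zeros e).work env = 1 + 2 * e.eval env := by
  simp [zeros, Gen.work, emitFixed, mul_comm]

theorem work_pieceGen (z : Arith) (env : List ℕ) :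
    (pieceGen z).work env = 4 * blockVar.eval env + 5 := by
  simp only [pieceGen, Gen.work, work_zeros, emitFixed]
  ring

section

variable {D n x r b m : ℕ}

theorem work_patternGen_le : (patternGen D).work [n, x, r, b, m] ≤ r ^ D * (4 * b + 6) + 5 := by
  have hloop := Gen.work_loop_le (e := rootVar.power D) (G := pieceGen loopVar₁)
    (env := [n, x, r, b, m]) (W := 4 * b + 5) fun z _ => (work_pieceGen ..).le
  simp only [eval_power, eval_var, List.getD_cons_succ, List.getD_cons_zero] at hloop
  simp only [patternGen, Gen.work, emitFixed, endBoth] at hloop ⊢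
  linarith

theorem work_skipGen_le {t : ℕ} (ht : t ≤ D) (hr : 0 < r) (hb : 0 < b) :
    (skipGen D t).work [n, x, r, b, m] ≤ 18 * (r * (r ^ D * b)) := by
  have hloops : (skipGen D t).work [n, x, r, b, m] =
      1 + r * (4 + r ^ (D - t) * (3 + r ^ t * (4 * b + 6))) := by
    simp only [skipGen, Gen.work, work_pieceGen, eval_var, eval_power, List.cons_append,
      List.nil_append, List.getD_cons_succ, List.getD_cons_zero, List.map_const',
      List.sum_replicate, List.length_range, smul_eq_mul]
    ring
  have hpow : r ^ (D - t) * r ^ t = r ^ D := pow_sub_mul_pow r ht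
  have hoffsets : r ^ (D - t) ≤ r ^ D := Nat.pow_le_pow_right hr (Nat.sub_le ..)
  have hpieces : 1 ≤ r ^ D := Nat.pow_pos hr
  have hgroup : 4 + r ^ (D - t) * (3 + r ^ t * (4 * b + 6)) ≤ 17 * (r ^ D * b) := by
    calc _ = 4 + 3 * r ^ (D - t) + r ^ (D - t) * r ^ t * (4 * b + 6) := by ring
      _ ≤ _ := by rw [hpow]; nlinarith
  have hone : 1 ≤ r * (r ^ D * b) := Nat.mul_pos hr (Nat.mul_pos hpieces hb)
  rw [hloops]
  linarith [Nat.mul_le_mul_left r hgroup]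

theorem work_skipsGen_le {t : ℕ} (ht : t ≤ D) (hr : 0 < r) (hb : 0 < b) :
    (skipsGen D t).work [n, x, r, b, m] ≤ 1 + t * (18 * (r * (r ^ D * b))) := by
  induction t with
  | zero => simp [skipsGen, Gen.work]
  | succ t ih =>
    rw [skipsGen, Gen.work, Nat.succ_mul]
    linarith [ih (by omega), work_skipGen_le (n := n) (x := x) (m := m)
      (show t ≤ D by omega) hr hb]

theorem work_reverseSkipsGen (t : ℕ) (env : List ℕ) :
    (reverseSkipsGen D t).work env = (skipsGen D t).work env := by
  induction t with
  | zero => rfl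
  | succ t ih => rw [reverseSkipsGen, skipsGen, Gen.work, Gen.work, ih, add_comm]

theorem work_gridGen_le {G : Gen} (hb : 0 < b) (hm : 0 < m)
    (h : ∀ i j, G.work [n, x, r, b, m, i, j] ≤ 4 * b + 3) :
    (gridGen G).work [n, x, r, b, m] ≤ 13 * (m * m * b) := by
  have hloops : (Gen.loop paddedVar (.loop paddedVar (.seq G .endString))).work [n, x, r, b, m] ≤
      1 + m * (1 + (1 + m * (1 + (4 * b + 4)))) :=
    Gen.work_loop_le fun i _ => Gen.work_loop_le fun j _ => Nat.add_le_add_right (h i j) 1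
  have hmm : m ≤ m * m := Nat.le_mul_of_pos_right _ hm
  have hmmb : m * m ≤ m * m * b := Nat.le_mul_of_pos_right _ hb
  rw [gridGen, Gen.work, Gen.work]
  linarith

theorem work_matrixGen_le (hb : 0 < b) (hm : 0 < m) :
    matrixGen.work [n, x, r, b, m] ≤ 39 * (m * m * b) := by
  have hmod : ∀ i, i % b ≤ b := fun i => (Nat.mod_lt i hb).le
  have hleft : (gridGen leftGen).work [n, x, r, b, m] ≤ 13 * (m * m * b) :=
    work_gridGen_le hb hm fun i j => by
      simp only [leftGen, Gen.work, markGen, work_zeros, eval_mod, eval_var,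
        List.getD_cons_succ, List.getD_cons_zero]
      linarith [hmod j]
  have hmid : (gridGen midGen).work [n, x, r, b, m] ≤ 13 * (m * m * b) :=
    work_gridGen_le hb hm fun j k => by
      simp only [midGen, Gen.work, markGen, work_zeros, eval_sub, eval_mod, eval_var,
        List.getD_cons_succ, List.getD_cons_zero]
      have := hmod k
      omega
  have hright : (gridGen rightGen).work [n, x, r, b, m] ≤ 13 * (m * m * b) :=
    work_gridGen_le hb hm fun k i => by
      simp only [rightGen, Gen.work, markGen, work_zeros, eval_sub, eval_mod, eval_var,
        List.getD_cons_succ, List.getD_cons_zero]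
      omega
  rw [matrixGen, Gen.work, Gen.work]
  linarith

end

theorem work_blockGen_le {q r : ℕ} (hq : 3 ≤ q) (hr : 0 < r) (n x : ℕ) :
    (blockGen (q + 2)).work [n, x, r, r ^ (q - 1), r ^ q] ≤ (36 * q + 140) * r ^ (3 * q - 1) := by
  have hb : 0 < r ^ (q - 1) := Nat.pow_pos hr
  have hpattern := work_patternGen_le (D := q + 2) (n := n) (x := x) (r := r)
    (b := r ^ (q - 1)) (m := r ^ q)
  have hskips := work_skipsGen_le (le_refl (q + 2)) (n := n) (x := x) (m := r ^ q) hr hb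
  have hmatrix := work_matrixGen_le (n := n) (x := x) (r := r) hb (Nat.pow_pos hr : 0 < r ^ q)
  have hcells : r * (r ^ (q + 2) * r ^ (q - 1)) ≤ r ^ (3 * q - 1) := by
    rw [← pow_add, ← pow_succ']
    exact Nat.pow_le_pow_right hr (by omega)
  have hcube : r ^ q * r ^ q * r ^ (q - 1) = r ^ (3 * q - 1) := by
    rw [← pow_add, ← pow_add]
    congr 1
    omega
  have hpieces : r ^ (q + 2) ≤ r ^ (q + 2) * r ^ (q - 1) := Nat.le_mul_of_pos_right _ hb
  have hcopies : r ^ (q + 2) * r ^ (q - 1) ≤ r * (r ^ (q + 2) * r ^ (q - 1)) :=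
    Nat.le_mul_of_pos_left _ hr
  have hone : 1 ≤ r ^ (3 * q - 1) := Nat.pow_pos hr
  rw [hcube] at hmatrix
  simp only [blockGen, Gen.work, emitFixed, endBoth, work_reverseSkipsGen]
  linarith [Nat.mul_le_mul_left (q + 2) hcells]

theorem work_guardedGen_le (q n y : ℕ) :
    (guardedGen q).work [n, y] ≤ 2 + if IsCeilRoot q n y then
      3 + (blockGen (q + 2)).work [n, y, y + 1, (y + 1) ^ (q - 1), (y + 1) ^ q] else 0 := by
  simp only [guardedGen, Gen.work, eval_lt, eval_power, eval_var, eval_add, eval_ofNat,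
    List.cons_append, List.nil_append, List.getD_cons_succ, List.getD_cons_zero, Nat.lt_succ_iff]
  grind

theorem sum_range_ite_eq {n x : ℕ} (hx : x < n) (c W : ℕ) :
    ((List.range n).map fun y => c + if y = x then W else 0).sum = n * c + W := by
  have hfinset : ((List.range n).map fun y => c + if y = x then W else 0).sum =
      ∑ y ∈ Finset.range n, (c + if y = x then W else 0) := rfl
  rw [hfinset, Finset.sum_add_distrib, Finset.sum_const, Finset.card_range, smul_eq_mul,
    Finset.sum_ite_eq', if_pos (Finset.mem_range.2 hx)]

theorem work_instanceGen_le {q n x : ℕ} (hq : 3 ≤ q) (hx : IsCeilRoot q n x) :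
    (instanceGen q).work [n] ≤ (36 * q + 150) * (x + 1) ^ (3 * q - 1) := by
  set W := (36 * q + 140) * (x + 1) ^ (3 * q - 1) with hW
  have hbody : ∀ y, 1 + (guardedGen q).work [n, y] ≤ 3 + if y = x then 3 + W else 0 := fun y => by
    have hguards := work_guardedGen_le q n y
    by_cases hy : IsCeilRoot q n y
    · obtain rfl := hy.unique hx
      rw [if_pos hy] at hguards
      rw [if_pos rfl]
      linarith [work_blockGen_le hq (Nat.succ_pos y) n y]
    · rw [if_neg hy] at hguards
      omega
  have hsum : (instanceGen q).work [n] ≤ 1 + (n * 3 + (3 + W)) := by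
    rw [instanceGen, Gen.work, ← sum_range_ite_eq (hx.lt (by omega))]
    exact Nat.add_le_add_left (List.sum_le_sum fun y _ => hbody y) 1
  have hn : n ≤ (x + 1) ^ (3 * q - 1) :=
    hx.2.trans (Nat.pow_le_pow_right (Nat.succ_pos x) (by omega))
  have hone : 1 ≤ (x + 1) ^ (3 * q - 1) := Nat.pow_pos (Nat.succ_pos x)
  linarith

theorem Gen.Describes.textSize_le_work {G : Gen} {X : ℕ → Template} (hG : G.Describes X) {x : Data}
    {P : List ℕ} {T : Data} (h : templateMap X x = [P] :: T) : textSize T ≤ G.work [order x] := by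
  have hlen := G.length_tokens_le_work [order x]
  rw [hG, length_templateTokens fun p => (letters x).getD p 0, ← templateMap, h] at hlen
  have hletters : (letters ([P] :: T)).length = P.length + textSize T := by
    simp only [letters, textSize, List.flatten_cons, List.flatten_append, List.flatten_nil,
      List.append_nil, List.length_append]
  omega

/-! ### The reduction -/

theorem exists_instance {q n x : ℕ} (hq : q ≠ 0) (hx : IsCeilRoot q n x)
    (A B C : Matrix (Fin n) (Fin n) Bool) :
    ∃ T, templateMap (template q) [rows A, rows B, rows C] =
        [pattern (x + 1) ((x + 1) ^ (q - 1)) ((x + 1) ^ (q + 2))] :: T ∧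
      IsInstance (pattern (x + 1) ((x + 1) ^ (q - 1)) ((x + 1) ^ (q + 2))) T ∧
      T.length = 2 * (q + 2) * (x + 1) + 5 ∧
      ((∃ j < T.length,
          OccEndsAt (pattern (x + 1) ((x + 1) ^ (q - 1)) ((x + 1) ^ (q + 2))) T j) ↔
        ∃ i j k, A i j = true ∧ B j k = true ∧ C k i = true) := by
  have hb : 0 < (x + 1) ^ (q - 1) := Nat.pow_pos (Nat.succ_pos x)
  have hm : (x + 1) ^ q = (x + 1) * (x + 1) ^ (q - 1) := (mul_pow_sub_one hq _).symm
  have hD : (x + 1) ^ q * (x + 1) * (x + 1) = (x + 1) ^ (q + 2) := by ring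
  have hmap := inst_blockTemplate (fun p => (letters [rows A, rows B, rows C]).getD p 0)
    (q + 2) n (x + 1) ((x + 1) ^ (q - 1)) ((x + 1) ^ q)
  rw [← template_eq_blockTemplate hq hx] at hmap
  refine ⟨_, by rw [templateMap, order_rows]; exact hmap,
    isInstance_text _ _ _ (Nat.succ_ne_zero x) hb hm (by omega), length_text .., ?_⟩
  rw [exists_occEndsAt_text_iff hb hm hD, hasTriangle_letters_rows_iff A B C hx.2]

section

variable {q : ℕ} (hq : 3 ≤ q)

include hq

theorem ceilRoot_le {n x : ℕ} (hx : IsCeilRoot q n x) :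
    (x + 1 : ℝ) ≤ 2 * (n : ℝ) ^ (q : ℝ)⁻¹ := by
  have hn : (1 : ℝ) ≤ n := by exact_mod_cast Nat.zero_lt_of_lt hx.1
  have hroot : (x : ℝ) ≤ (n : ℝ) ^ (q : ℝ)⁻¹ := by
    rw [Real.le_rpow_inv_iff_of_pos x.cast_nonneg n.cast_nonneg (by positivity)]
    exact_mod_cast hx.1.le
  linarith [Real.one_le_rpow hn (inv_nonneg.2 q.cast_nonneg)]

theorem ceilRoot_pow_le {n x : ℕ} (hx : IsCeilRoot q n x) :
    (x + 1 : ℝ) ^ (3 * q - 1) ≤ 2 ^ (3 * q - 1) * (n : ℝ) ^ (3 - (q : ℝ)⁻¹) := by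
  have hexponent : (3 : ℝ) - (q : ℝ)⁻¹ = (q : ℝ)⁻¹ * (3 * q - 1 : ℕ) := by
    have hq0 : (q : ℝ) ≠ 0 := by positivity
    rw [Nat.cast_sub (by omega)]
    push_cast
    field_simp
  rw [hexponent, Real.rpow_mul_natCast n.cast_nonneg, ← mul_pow]
  exact pow_le_pow_left₀ (by positivity) (ceilRoot_le hq hx) _

variable {r : ℕ} (hr : 0 < r)

include hr

theorem length_pattern_le :
    (pattern r (r ^ (q - 1)) (r ^ (q + 2))).length ≤ 7 * r ^ (2 * q + 1) := by
  have hcells : r ^ (q + 2) * r ^ (q - 1) = r ^ (2 * q + 1) := by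
    rw [← pow_add]
    congr 1
    omega
  have hpieces : r ^ (q + 2) ≤ r ^ (2 * q + 1) := Nat.pow_le_pow_right hr (by omega)
  have hone : 1 ≤ r ^ (2 * q + 1) := Nat.pow_pos hr
  rw [length_pattern]
  linarith

theorem length_pattern_rpow_le {ε : ℝ} (hε : 2 / (q : ℝ) ≤ ε) :
    ((pattern r (r ^ (q - 1)) (r ^ (q + 2))).length : ℝ) ^ (3 / 2 - ε) ≤
      49 * (r : ℝ) ^ (3 * q - 2) := by
  have hr1 : (1 : ℝ) ≤ r := by exact_mod_cast hr
  have hq3 : (3 : ℝ) ≤ q := by exact_mod_cast hq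
  have hone : (1 : ℝ) ≤ (pattern r (r ^ (q - 1)) (r ^ (q + 2))).length := by
    exact_mod_cast Nat.succ_pos _
  have hlen : ((pattern r (r ^ (q - 1)) (r ^ (q + 2))).length : ℝ) ≤
      7 * (r : ℝ) ^ (2 * q + 1) := by exact_mod_cast length_pattern_le hq hr
  have hdiv : 2 / (q : ℝ) ≤ 2 / 3 := div_le_div_of_nonneg_left (by norm_num) (by norm_num) hq3
  have hdiv0 : 0 < 2 / (q : ℝ) := by positivity
  have hexponent : (2 * q + 1) * (3 / 2 - 2 / (q : ℝ)) ≤ (3 * q - 2 : ℕ) := by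
    have hexpand : (2 * (q : ℝ) + 1) * (3 / 2 - 2 / q) = 3 * q - 5 / 2 - 2 / q := by
      field_simp
      ring
    rw [Nat.cast_sub (by omega)]
    push_cast
    linarith
  calc _ ≤ ((pattern r (r ^ (q - 1)) (r ^ (q + 2))).length : ℝ) ^ (3 / 2 - 2 / (q : ℝ)) :=
        Real.rpow_le_rpow_of_exponent_le hone (by linarith)
    _ ≤ (7 * (r : ℝ) ^ (2 * q + 1)) ^ (3 / 2 - 2 / (q : ℝ)) :=
        Real.rpow_le_rpow (by linarith) hlen (by linarith)
    _ = 7 ^ (3 / 2 - 2 / (q : ℝ)) * (r : ℝ) ^ ((2 * q + 1) * (3 / 2 - 2 / (q : ℝ))) := by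
        rw [Real.mul_rpow (by norm_num) (by positivity), ← Real.rpow_natCast_mul r.cast_nonneg]
        push_cast
        rfl
    _ ≤ 7 ^ (2 : ℝ) * (r : ℝ) ^ ((3 * q - 2 : ℕ) : ℝ) := by
        gcongr
        · norm_num
        · linarith
    _ = _ := by rw [Real.rpow_natCast]; norm_num

theorem reduction_time_le {ε : ℝ} (hε : 2 / (q : ℝ) ≤ ε) (C : ℕ) (K : ℝ) {W N : ℕ}
    (hW : W ≤ (36 * q + 150) * r ^ (3 * q - 1)) (hN : N ≤ W) :
    C * W + K * ((2 * (q + 2) * r + 5 : ℕ) *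
          ((pattern r (r ^ (q - 1)) (r ^ (q + 2))).length : ℝ) ^ (3 / 2 - ε) + N) +
        30 * (2 * (q + 2) * r + 5 : ℕ) + 14 ≤
      ((C + |K|) * (36 * q + 150) + (49 * |K| + 44) * (2 * q + 9)) * (r : ℝ) ^ (3 * q - 1) := by
  set U := (r : ℝ) ^ (3 * q - 1) with hU
  set p := ((pattern r (r ^ (q - 1)) (r ^ (q + 2))).length : ℝ) ^ (3 / 2 - ε)
  have hr1 : (1 : ℝ) ≤ r := by exact_mod_cast hr
  have hrU : (r : ℝ) ≤ U := le_self_pow₀ hr1 (by omega)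
  have hWU : (W : ℝ) ≤ (36 * q + 150) * U := by
    rw [hU]
    exact_mod_cast hW
  have hNU : (N : ℝ) ≤ (36 * q + 150) * U := le_trans (by exact_mod_cast hN) hWU
  have hlen : ((2 * (q + 2) * r + 5 : ℕ) : ℝ) ≤ (2 * q + 9) * r := by
    push_cast
    linarith
  have hmatching : (2 * (q + 2) * r + 5 : ℕ) * p ≤ 49 * (2 * q + 9) * U := by
    calc _ ≤ ((2 * q + 9) * r) * (49 * (r : ℝ) ^ (3 * q - 2)) :=
          mul_le_mul hlen (length_pattern_rpow_le hq hr hε) (by positivity) (by positivity)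
      _ = 49 * (2 * q + 9) * (r : ℝ) ^ (3 * q - 2 + 1) := by ring
      _ = _ := by rw [hU, show 3 * q - 2 + 1 = 3 * q - 1 by omega]
  have hK : K * ((2 * (q + 2) * r + 5 : ℕ) * p + N) ≤
      |K| * (49 * (2 * q + 9) * U + (36 * q + 150) * U) :=
    (mul_le_mul_of_nonneg_right (le_abs_self K) (by positivity)).trans
      (mul_le_mul_of_nonneg_left (add_le_add hmatching hNU) (abs_nonneg K))
  have hC : (C : ℝ) * W ≤ C * ((36 * q + 150) * U) :=
    mul_le_mul_of_nonneg_left hWU C.cast_nonneg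
  have hlast : 30 * ((2 * (q + 2) * r + 5 : ℕ) : ℝ) + 14 ≤ 44 * ((2 * q + 9) * U) := by
    have hlenU : (2 * q + 9 : ℝ) * r ≤ (2 * q + 9) * U := by gcongr
    have hone : (1 : ℝ) ≤ (2 * q + 9) * U :=
      one_le_mul_of_one_le_of_one_le (by linarith [q.cast_nonneg (α := ℝ)]) (hr1.trans hrU)
    linarith
  linarith

end

theorem solvesTD_reduceTo {M : Prog} {ε : ℝ} {q : ℕ} (hq : 3 ≤ q) (hε : 2 / (q : ℝ) ≤ ε)
    (hM : SolvesEDSM M fun m n N => (n : ℝ) * (m : ℝ) ^ (3 / 2 - ε) + N) :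
    SolvesTD (reduceTo 6 (instanceGen q).program M) fun n => (n : ℝ) ^ (3 - (q : ℝ)⁻¹) := by
  obtain ⟨c, κ, K, hreduce⟩ := (describes_instanceGen q).exec_reduceTo hM
  set K' := (c + |K|) * (36 * q + 150) + (49 * |K| + 44) * (2 * q + 9)
  refine ⟨K' * 2 ^ (3 * q - 1), κ, fun n A B C hn w hw => ?_⟩
  obtain ⟨x, hx⟩ := exists_isCeilRoot (q := q) (by omega) (Nat.one_le_iff_ne_zero.1 hn)
  obtain ⟨T, hmap, hT, hlen, htriangle⟩ := exists_instance (by omega) hx A B C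
  obtain ⟨σ, t, hexec, hout, ht⟩ := hreduce _ _ _ hmap hT w hw
  have hN := (describes_instanceGen q).textSize_le_work hmap
  rw [order_rows] at hN ht
  rw [hlen] at ht
  refine ⟨σ, t, hexec, by simpa only [htriangle] using hout, ?_⟩
  calc (t : ℝ) ≤ K' * ((x + 1 : ℕ) : ℝ) ^ (3 * q - 1) := ht.trans <|
        reduction_time_le hq (Nat.succ_pos x) hε c K (work_instanceGen_le hq hx) hN
    _ ≤ K' * (2 ^ (3 * q - 1) * (n : ℝ) ^ (3 - (q : ℝ)⁻¹)) := by
        push_cast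
        gcongr
        exact ceilRoot_pow_le hq hx
    _ = _ := by ring

theorem Gen.Describes.transforms {G : Gen} {X : ℕ → Template} (hG : G.Describes X) :
    Transforms G.program 6 (templateMap X) := by
  obtain ⟨C, κ, hprogram⟩ := hG.exec_program
  refine ⟨κ, fun x w hw => ?_⟩
  obtain ⟨σ, t, hexec, hmem, -⟩ := hprogram x w hw
  exact ⟨σ, t, hexec, hmem⟩

end EDSM

theorem theorem1 (𝒮 : Set EDSM.Prog) (ε : ℝ) (hε : 0 < ε)
    (h : ∃ M, EDSM.Combinatorial 𝒮 M ∧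
      EDSM.SolvesEDSM M fun m n N => (n : ℝ) * (m : ℝ) ^ (3 / 2 - ε) + N) :
    ∃ Q, EDSM.Combinatorial 𝒮 Q ∧ EDSM.IsTrulySubcubicTD Q := by
  obtain ⟨M, hM, hsolves⟩ := h
  obtain ⟨q, hq⟩ := exists_nat_ge (max 3 (2 / ε))
  have hq3 : 3 ≤ q := by exact_mod_cast (le_max_left _ _).trans hq
  have hq0 : (0 : ℝ) < q := by positivity
  have hqε : 2 / (q : ℝ) ≤ ε := by
    rw [div_le_comm₀ hq0 hε]
    exact (le_max_right _ _).trans hq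
  exact ⟨_, .reduce (by omega) (EDSM.isLocal_templateMap _)
      (EDSM.describes_instanceGen q).transforms hM,
    (q : ℝ)⁻¹, inv_pos.2 hq0, EDSM.solvesTD_reduceTo hq3 hqε hsolves⟩
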